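/- \textbf{Theorem (variance reduction around the optimal solution).} Let $d\ge 1$, let $V:\mathbb{R}^d\to\mathbb{R}$ be twice continuously differentiable with $\int_{\mathbb{R}^d} e^{-V(x)}\,dx<\infty$, and let $\pi$ be the probability measure on $\mathbb{R}^d$ with density proportional to $e^{-V}$. Assume that the Laplacian $\Delta V=\sum_{i=1}^d \partial^2V/\partial x_i^2$ is $\ell$-Lipschitz for some $\ell\ge 0$, i.e. $|\Delta V(x)-\Delta V(y)|\le \ell\|x-y\|$ for all $x,y\in\mathbb{R}^d$. Let $\hat\pi=\mathcal N(\hat m,\hat\Sigma)$, with $\hat\Sigma$ positive definite, be a minimizer of $\mu\mapsto D_{\mathrm{KL}}(\mu\,\|\,\pi)$ over all Gaussian distributions $\mu$ on $\mathbb{R}^d$ with positive definite covariance matrix. Let $W_2$ be the 2-Wasserstein distance, $W_2^2(\mu,\nu)=\inf_\gamma\int\|x-y\|^2\,d\gamma(x,y)$, the infimum being over all couplings $\gamma$ of $\mu$ and $\nu$. Let $c\in(0,2)$. Then $r:=(2-c)\operatorname{Tr}(\hat\Sigma^{-1})>0$, and for every $\mu=\mathcal N(m,\Sigma)$ with $\Sigma$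 positive definite and $$2\ell\,W_2(\mu,\hat\pi)+c\,\bigl|\operatorname{Tr}(\Sigma^{-1})-\operatorname{Tr}(\hat\Sigma^{-1})\bigr|<r,$$ the control-variate estimator $\nabla V(X)-c\,\Sigma^{-1}(X-m)$ with $X\sim\mu$ has strictly smaller variance than the Monte Carlo estimator $\nabla V(X)$, where the variance of a random vector $Y$ is $\mathbb{E}\|Y-\mathbb{E}Y\|^2$. -/

import Mathlib

open MeasureTheory ProbabilityTheory
open scoped ENNReal NNReal Gradient Laplacian

noncomputable section

/-- The Bures–Wasserstein space: the Gaussian distributions on `ℝᵈ` with non-degenerate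
covariance matrix. -/
def buresWasserstein (d : ℕ) : Set (Measure (EuclideanSpace ℝ (Fin d))) :=
  {μ | ∃ (m : EuclideanSpace ℝ (Fin d)) (S : Matrix (Fin d) (Fin d) ℝ),
    S.PosDef ∧ μ = multivariateGaussian m S}

/-- The target distribution `π(x) ∝ exp (-V x)`, i.e. the measure with Lebesgue density
`exp (-V x) / ∫ exp (-V)`. It is a probability measure as soon as `exp (-V)` is integrable. -/
def targetMeasure {d : ℕ} (V : EuclideanSpace ℝ (Fin d) → ℝ) :
    Measure (EuclideanSpace ℝ (Fin d)) :=
  (volume : Measure (EuclideanSpace ℝ (Fin d))).tilted (fun x => -V x)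

/-- `ν` is an optimal Gaussian approximation of the target `π ∝ exp (-V)`: it minimises the
Kullback–Leibler divergence `D_KL(· ‖ π)` over the Bures–Wasserstein space. -/
def IsOptimalGaussian {d : ℕ} (V : EuclideanSpace ℝ (Fin d) → ℝ)
    (ν : Measure (EuclideanSpace ℝ (Fin d))) : Prop :=
  ν ∈ buresWasserstein d ∧
    IsMinOn (fun μ => InformationTheory.klDiv μ (targetMeasure V)) (buresWasserstein d) ν

/-- The transport plans between `μ` and `ν`. -/
def transportPlans {E : Type*} [MeasurableSpace E] (μ ν : Measure E) : Set (Measure (E × E)) :=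
  {γ | γ.map Prod.fst = μ ∧ γ.map Prod.snd = ν}

/-- The squared 2-Wasserstein distance, as an extended nonnegative real. -/
def wassersteinSq {E : Type*} [MeasurableSpace E] [NormedAddCommGroup E] (μ ν : Measure E) :
    ℝ≥0∞ :=
  ⨅ γ ∈ transportPlans μ ν, ∫⁻ p, ‖p.1 - p.2‖ₑ ^ 2 ∂γ

/-- The 2-Wasserstein distance, as a real number (the infimum defining it is finite for
probability measures with finite second moment, in particular for Gaussians). -/
def W₂ {E : Type*} [MeasurableSpace E] [NormedAddCommGroup E] (μ ν : Measure E) : ℝ :=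
  √(wassersteinSq μ ν).toReal

/-- The variance `𝔼 ‖Y - 𝔼 Y‖²` of a random vector, as an extended nonnegative real. On a
probability space it is `∞` exactly when (an a.e. strongly measurable) `Y` is not square
integrable. -/
def vecVariance {Ω E : Type*} [MeasurableSpace Ω] [NormedAddCommGroup E] [NormedSpace ℝ E]
    (Y : Ω → E) (P : Measure Ω) : ℝ≥0∞ :=
  ∫⁻ ω, ‖Y ω - ∫ ω', Y ω' ∂P‖ₑ ^ 2 ∂P

/-- The Monte Carlo estimator `∇V(x)`, at the sample `x`. -/
def mcEstimator {d : ℕ} (V : EuclideanSpace ℝ (Fin d) → ℝ) (x : EuclideanSpace ℝ (Fin d)) :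
    EuclideanSpace ℝ (Fin d) :=
  ∇ V x

/-- The control-variate estimator `∇V(x) - c Σ⁻¹ (x - m)`, at the sample `x`. -/
def cvEstimator {d : ℕ} (V : EuclideanSpace ℝ (Fin d) → ℝ) (c : ℝ)
    (m : EuclideanSpace ℝ (Fin d)) (S : Matrix (Fin d) (Fin d) ℝ)
    (x : EuclideanSpace ℝ (Fin d)) : EuclideanSpace ℝ (Fin d) :=
  ∇ V x - c • Matrix.toEuclideanCLM (𝕜 := ℝ) S⁻¹ (x - m)

end

/-! Put `D = c Σ⁻¹(X - m)`, which is centred. Expanding the square, subtracting `D` from `∇V(X)`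
lowers the variance as soon as `𝔼‖D‖² < 2 𝔼⟨D, ∇V(X)⟩` (`vecVariance_sub_lt`). The left side is `c²
Tr Σ⁻¹`; by Stein's identity (`integral_fderiv_eq_integral_laplacian`) the right side is `2c 𝔼_μ
ΔV`. It remains to see that `c Tr Σ⁻¹ < 2 𝔼_μ ΔV`.

At the optimum, `𝔼 ΔV ≥ Tr Σ̂⁻¹`: for the image of the standard Gaussian under `z ↦ m + Az`, the
divergence to `π` is a constant plus `𝔼 V(m + Az) - log |det A|` (`toReal_klDiv_gaussian`), and
moving `A = √Σ̂` in the direction `√Σ̂⁻¹` gives this bound after Stein's identity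
(`IsOptimalGaussian.trace_inv_le_integral`). Since `ΔV` is `ℓ`-Lipschitz, passing from `π̂` to `μ`
costs at most `ℓ W₂(μ, π̂)` (`abs_integral_sub_integral_le_mul_W₂`), and the smallness condition
absorbs this loss and the change of trace.

The analytic difficulty is that no growth of `V` is assumed, while every expectation above needs
some. A Lipschitz Laplacian alone gives none, as harmonic functions show; integrability of `exp
(-V)` supplies the missing one-sided control. Averages of `V` against a truncated paraboloid differ
from multiples of `V(x)` by an explicit integral of `ΔV` (`hasDerivAt_weightedMean`). Integrability
bounds these averages below, hence `V` below. A Harnack-type comparison of averages at two scales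
(`weightedMean_le_weightedMean_zero`) then bounds `V` above by a cubic, and differences of averages
transfer the cubic bound to `∇V`. -/

/-! ### Truncated paraboloid cutoffs and their squares. -/

section CutoffFunctions

variable {E : Type*} [NormedAddCommGroup E]

/-- The truncated paraboloid `max 0 (1 - ‖y‖²)`. -/
def truncParaboloid (y : E) : ℝ := max 0 (1 - ‖y‖ ^ 2)

lemma truncParaboloid_nonneg (y : E) : 0 ≤ truncParaboloid y := le_max_left _ _

lemma truncParaboloid_le_one (y : E) : truncParaboloid y ≤ 1 :=
  max_le zero_le_one (by nlinarith [sq_nonneg ‖y‖])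

lemma truncParaboloid_zero : truncParaboloid (0 : E) = 1 := by simp [truncParaboloid]

lemma truncParaboloid_eq_zero {y : E} (hy : 1 ≤ ‖y‖) : truncParaboloid y = 0 :=
  max_eq_left (by nlinarith)

lemma truncParaboloid_of_norm_le {y : E} (hy : ‖y‖ ≤ 1) : truncParaboloid y = 1 - ‖y‖ ^ 2 :=
  max_eq_right (by nlinarith [norm_nonneg y])

lemma norm_le_one_of_truncParaboloid_ne_zero {y : E} (hy : truncParaboloid y ≠ 0) : ‖y‖ ≤ 1 := by
  by_contra! h
  exact hy (truncParaboloid_eq_zero h.le)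

lemma continuous_truncParaboloid : Continuous (truncParaboloid : E → ℝ) := by
  unfold truncParaboloid
  fun_prop

lemma hasCompactSupport_truncParaboloid [ProperSpace E] :
    HasCompactSupport (truncParaboloid : E → ℝ) :=
  HasCompactSupport.intro (isCompact_closedBall 0 1) fun y hy => by
    rw [Metric.mem_closedBall, dist_zero_right, not_le] at hy
    exact truncParaboloid_eq_zero hy.le

lemma abs_truncParaboloid_sub_le (x y : E) :
    |truncParaboloid x - truncParaboloid y| ≤ 2 * ‖x - y‖ := by
  have key : ∀ x y : E, truncParaboloid x - truncParaboloid y ≤ 2 * ‖x - y‖ := fun x y => by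
    have h1 := norm_sub_norm_le y x
    rw [norm_sub_rev] at h1
    rcases le_total 1 ‖x‖ with hx | hx
    · rw [truncParaboloid_eq_zero hx]
      linarith [truncParaboloid_nonneg y, norm_nonneg (x - y)]
    · rw [truncParaboloid_of_norm_le hx]
      rcases le_total ‖y‖ 1 with hy | hy
      · rw [truncParaboloid_of_norm_le hy]
        nlinarith [norm_nonneg x, norm_nonneg y, norm_nonneg (x - y)]
      · rw [truncParaboloid_eq_zero hy]
        nlinarith [norm_nonneg x]
  rw [abs_le]
  have := key y x
  rw [norm_sub_rev] at this
  exact ⟨by linarith, key x y⟩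

/-- Squaring removes the kink at the origin, where the function is `O(t²)`. -/
lemma hasDerivAt_max_zero_sq (t : ℝ) :
    HasDerivAt (fun t : ℝ => (max 0 t) ^ 2) (2 * max 0 t) t := by
  rcases lt_trichotomy t 0 with ht | rfl | ht
  · rw [max_eq_left ht.le, mul_zero]
    refine (hasDerivAt_const t (0 : ℝ)).congr_of_eventuallyEq ?_
    filter_upwards [Iio_mem_nhds ht] with u hu
    simp [max_eq_left (le_of_lt (Set.mem_Iio.1 hu))]
  · rw [hasDerivAt_iff_isLittleO]
    simp only [max_self, mul_zero, smul_zero, sub_zero, ne_eq, OfNat.ofNat_ne_zero,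
      not_false_eq_true, zero_pow]
    refine (Asymptotics.isBigO_of_le _ (g := fun t : ℝ => t ^ 2) fun u => ?_).trans_isLittleO
      (Asymptotics.isLittleO_pow_id one_lt_two)
    rw [Real.norm_of_nonneg (sq_nonneg _), Real.norm_of_nonneg (sq_nonneg _)]
    rcases le_total 0 u with hu | hu
    · rw [max_eq_right hu]
    · rw [max_eq_left hu]; nlinarith
  · rw [max_eq_right ht.le]
    have : HasDerivAt (fun t : ℝ => t ^ 2) (2 * t) t := by
      simpa using hasDerivAt_pow 2 t
    refine this.congr_of_eventuallyEq ?_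
    filter_upwards [Ioi_mem_nhds ht] with u hu
    simp [max_eq_right (le_of_lt (Set.mem_Ioi.1 hu))]

variable [InnerProductSpace ℝ E]

/-- This is the reason for using a paraboloid: the radial field `y` weighted by the cutoff is itself
a gradient of a compactly supported function, so that radial derivatives of `V` can be integrated by
parts into `ΔV`. -/
lemma hasGradientAt_truncParaboloid_sq [CompleteSpace E] (y : E) :
    HasGradientAt (fun y : E => truncParaboloid y ^ 2) (-(4 * truncParaboloid y) • y) y := by
  rw [hasGradientAt_iff_hasFDerivAt]
  have h2 := ((hasStrictFDerivAt_norm_sq (F := E) y).hasFDerivAt.const_sub 1)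
  have h1 := (hasDerivAt_max_zero_sq (1 - ‖y‖ ^ 2)).comp_hasFDerivAt y h2
  refine h1.congr_fderiv ?_
  ext v
  simp [truncParaboloid]
  ring

lemma hasGradientAt_truncParaboloid_smul_sq [CompleteSpace E] (r : ℝ) (y : E) :
    HasGradientAt (fun y : E => truncParaboloid (r • y) ^ 2)
      (-(4 * r ^ 2 * truncParaboloid (r • y)) • y) y := by
  rw [hasGradientAt_iff_hasFDerivAt]
  have h1 := (hasGradientAt_truncParaboloid_sq (r • y)).hasFDerivAt.comp y
    ((hasFDerivAt_id y).const_smul r)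
  refine h1.congr_fderiv ?_
  ext v
  simp
  ring

variable [FiniteDimensional ℝ E] [MeasurableSpace E] [BorelSpace E]

lemma integrable_mul_of_hasCompactSupport {f g : E → ℝ} (hf : Continuous f) (hg : Continuous g)
    (hc : HasCompactSupport g) : Integrable (fun x => f x * g x) volume :=
  (hf.mul hg).integrable_of_hasCompactSupport hc.mul_left

lemma integral_truncParaboloid_pos : 0 < ∫ y : E, truncParaboloid y :=
  continuous_truncParaboloid.integral_pos_of_hasCompactSupport_nonneg_nonzero
    hasCompactSupport_truncParaboloid truncParaboloid_nonneg
    (by rw [truncParaboloid_zero]; exact one_ne_zero)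

end CutoffFunctions

/-! ### Green's identity against compactly supported functions. -/

section IntegrationByParts

variable {E : Type*} [NormedAddCommGroup E] [InnerProductSpace ℝ E] [FiniteDimensional ℝ E]

lemma laplacian_eq_sum_fderiv (V : E → ℝ) (x : E) :
    Δ V x = ∑ i, fderiv ℝ (fderiv ℝ V) x (stdOrthonormalBasis ℝ E i)
      (stdOrthonormalBasis ℝ E i) := by
  rw [InnerProductSpace.laplacian_eq_iteratedFDeriv_stdOrthonormalBasis]
  simp [iteratedFDeriv_two_apply]

variable [MeasurableSpace E] [BorelSpace E]

/-- Green's identity: the divergence of `∇V` tested against a compactly supported `C¹`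
function. -/
lemma integral_fderiv_apply_gradient {V : E → ℝ} (hV : ContDiff ℝ 2 V) {q : E → ℝ} {g : E → E}
    (hq : ∀ y, HasGradientAt q (g y) y) (hg : Continuous g) (hc : HasCompactSupport q)
    (x : E) (s : ℝ) :
    ∫ y, fderiv ℝ V (x + s • y) (g y) = -s * ∫ y, Δ V (x + s • y) * q y := by
  set b := stdOrthonormalBasis ℝ E
  have hq_cont : Continuous q :=
    continuous_iff_continuousAt.2 fun y => (hq y).differentiableAt.continuousAt
  have hqb : ∀ y i, fderiv ℝ q y (b i) = inner ℝ (g y) (b i) := fun y i => (hq y).fderiv_apply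
  have hV1 : ContDiff ℝ 1 (fderiv ℝ V) := hV.fderiv_right (by norm_num)
  have hV1d : Differentiable ℝ (fderiv ℝ V) := hV1.differentiable one_ne_zero
  have hV2 : Continuous (fderiv ℝ (fderiv ℝ V)) := hV1.continuous_fderiv one_ne_zero
  have hD : ∀ i y, HasFDerivAt (fun y => fderiv ℝ V (x + s • y) (b i))
      (s • (fderiv ℝ (fderiv ℝ V) (x + s • y)).flip (b i)) y := fun i y => by
    have h := ((hV1d (x + s • y)).hasFDerivAt.comp y
      (((hasFDerivAt_id y).const_smul s).const_add x)).clm_apply (hasFDerivAt_const (b i) y)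
    refine h.congr_fderiv ?_
    ext v
    simp
  have hDb : ∀ i y, fderiv ℝ (fun y => fderiv ℝ V (x + s • y) (b i)) y (b i)
      = s * fderiv ℝ (fderiv ℝ V) (x + s • y) (b i) (b i) := fun i y => by
    rw [(hD i y).fderiv]; simp
  have hcg : ∀ i, HasCompactSupport fun y => inner ℝ (g y) (b i) := fun i => by
    simp_rw [← hqb]
    exact (hc.fderiv ℝ).comp_left (g := fun L : E →L[ℝ] ℝ => L (b i)) (by simp)
  have e1 : ∀ y, fderiv ℝ V (x + s • y) (g y)
      = ∑ i, fderiv ℝ V (x + s • y) (b i) * fderiv ℝ q y (b i) := fun y => by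
    conv_lhs => rw [← b.sum_repr' (g y), map_sum]
    refine Finset.sum_congr rfl fun i _ => ?_
    rw [hqb, map_smul, smul_eq_mul, mul_comm, real_inner_comm]
  have i1 : ∀ i, Integrable (fun y => fderiv ℝ V (x + s • y) (b i) * fderiv ℝ q y (b i))
      volume := fun i => by
    simp_rw [hqb]
    exact integrable_mul_of_hasCompactSupport
      ((hV1.continuous.comp (by fun_prop)).clm_apply continuous_const) (by fun_prop) (hcg i)
  have i2 : ∀ i, Integrable (fun y => fderiv ℝ (fderiv ℝ V) (x + s • y) (b i) (b i) * q y)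
      volume := fun i =>
    integrable_mul_of_hasCompactSupport (((hV2.comp (by fun_prop)).clm_apply
      continuous_const).clm_apply continuous_const) hq_cont hc
  have e2 : ∀ i, ∫ y, fderiv ℝ V (x + s • y) (b i) * fderiv ℝ q y (b i)
      = -s * ∫ y, fderiv ℝ (fderiv ℝ V) (x + s • y) (b i) (b i) * q y := fun i => by
    rw [integral_mul_fderiv_eq_neg_fderiv_mul_of_integrable _ (i1 i)]
    · simp_rw [hDb, mul_assoc]
      rw [integral_const_mul, neg_mul]
    · exact integrable_mul_of_hasCompactSupport
        ((hV1.continuous.comp (by fun_prop)).clm_apply continuous_const) hq_cont hc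
    · exact fun y _ => (hD i y).differentiableAt
    · exact fun y _ => (hq y).differentiableAt
    · simp_rw [hDb, mul_assoc]
      exact (i2 i).const_mul s
  simp_rw [e1]
  rw [integral_finsetSum _ fun i _ => i1 i]
  simp_rw [e2, laplacian_eq_sum_fderiv, Finset.sum_mul]
  rw [integral_finsetSum _ fun i _ => i2 i, Finset.mul_sum]

end IntegrationByParts

/-! ### Cubic growth of `V` and `∇V`. -/

section Growth

variable {E : Type*} [NormedAddCommGroup E] [InnerProductSpace ℝ E] [FiniteDimensional ℝ E]

lemma hasCompactSupport_truncParaboloid_sq :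
    HasCompactSupport fun y : E => truncParaboloid y ^ 2 :=
  hasCompactSupport_truncParaboloid.comp_left (g := fun t : ℝ => t ^ 2) (by simp)

lemma abs_laplacian_le {V : E → ℝ} {ℓ : ℝ≥0} (hℓ : LipschitzWith ℓ (Δ V)) (x : E) :
    |Δ V x| ≤ (|Δ V 0| + ℓ) * (1 + ‖x‖) := by
  have h := hℓ.dist_le_mul x 0
  rw [Real.dist_eq, dist_zero_right] at h
  have := abs_sub_abs_le_abs_sub (Δ V x) (Δ V 0)
  nlinarith [abs_nonneg (Δ V 0), norm_nonneg x, ℓ.coe_nonneg]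

variable [MeasurableSpace E] [BorelSpace E]

/-- The (unnormalised) average of `V` at scale `s` around `x`, weighted by the truncated
paraboloid. -/
noncomputable def weightedMean (V : E → ℝ) (s : ℝ) (x : E) : ℝ := ∫ y, V (x + s • y) * truncParaboloid y

lemma weightedMean_zero (V : E → ℝ) (x : E) :
    weightedMean V 0 x = V x * ∫ y : E, truncParaboloid y := by
  simp [weightedMean, integral_const_mul]

lemma integrable_weightedMean {V : E → ℝ} (hV : Continuous V) (s : ℝ) (x : E) :
    Integrable (fun y => V (x + s • y) * truncParaboloid y) volume :=
  integrable_mul_of_hasCompactSupport (hV.comp (by fun_prop)) continuous_truncParaboloid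
    hasCompactSupport_truncParaboloid

lemma integrable_mul_truncParaboloid_sq {f : E → ℝ} (hf : Continuous f) :
    Integrable (fun y => f y * truncParaboloid y ^ 2) volume :=
  integrable_mul_of_hasCompactSupport hf (continuous_truncParaboloid.pow 2)
    hasCompactSupport_truncParaboloid_sq

lemma abs_integral_mul_truncParaboloid_sq_le {f : E → ℝ} {L : ℝ}
    (hf : ∀ y, ‖y‖ ≤ 1 → |f y| ≤ L) :
    |∫ y, f y * truncParaboloid y ^ 2| ≤ L * ∫ y : E, truncParaboloid y ^ 2 := by
  rw [← integral_const_mul, ← Real.norm_eq_abs]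
  refine norm_integral_le_of_norm_le (integrable_mul_truncParaboloid_sq continuous_const)
    (.of_forall fun y => ?_)
  rw [norm_mul, Real.norm_of_nonneg (sq_nonneg (truncParaboloid y)), Real.norm_eq_abs]
  rcases le_total ‖y‖ 1 with hy | hy
  · gcongr
    exact hf y hy
  · simp [truncParaboloid_eq_zero hy]

/-- Differentiating in the scale produces `∇V(x + s y) · y` times the cutoff, which is `-1/4` of
`∇V` paired with the gradient of the squared cutoff; Green's identity turns it into `ΔV`. This
replaces the mean value property of harmonic functions. -/
lemma hasDerivAt_weightedMean {V : E → ℝ} (hV : ContDiff ℝ 2 V) (x : E) (s : ℝ) :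
    HasDerivAt (fun s => weightedMean V s x)
      (s / 4 * ∫ y, Δ V (x + s • y) * truncParaboloid y ^ 2) s := by
  have hV1 : Continuous (fderiv ℝ V) := hV.continuous_fderiv two_ne_zero
  -- This ball contains every `x + r • y` with `|r - s| < 1` and `‖y‖ ≤ 1`.
  obtain ⟨C, hC⟩ := (isCompact_closedBall x (|s| + 1)).exists_bound_of_continuousOn
    hV1.continuousOn
  have key := hasDerivAt_integral_of_dominated_loc_of_deriv_le (μ := (volume : Measure E))
    (F := fun s y => V (x + s • y) * truncParaboloid y)
    (F' := fun s y => fderiv ℝ V (x + s • y) y * truncParaboloid y)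
    (bound := fun y => C * truncParaboloid y) (Metric.ball_mem_nhds s one_pos)
    (.of_forall fun r => (integrable_weightedMean hV.continuous r x).aestronglyMeasurable)
    (integrable_weightedMean hV.continuous s x)
    (((hV1.comp (by fun_prop)).clm_apply continuous_id).mul
      continuous_truncParaboloid).aestronglyMeasurable
    (.of_forall fun y r hr => ?_)
    (integrable_mul_of_hasCompactSupport continuous_const continuous_truncParaboloid
      hasCompactSupport_truncParaboloid)
    (.of_forall fun y r _ => ?_)
  · refine key.2.congr_deriv ?_
    have h := integral_fderiv_apply_gradient hV hasGradientAt_truncParaboloid_sq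
      (by have := continuous_truncParaboloid (E := E); fun_prop)
      hasCompactSupport_truncParaboloid_sq x s
    have e : ∀ y, fderiv ℝ V (x + s • y) (-(4 * truncParaboloid y) • y)
        = -4 * (fderiv ℝ V (x + s • y) y * truncParaboloid y) := fun y => by
      rw [map_smul, smul_eq_mul]; ring
    simp_rw [e] at h
    rw [integral_const_mul] at h
    linarith
  · rw [norm_mul, Real.norm_of_nonneg (truncParaboloid_nonneg y)]
    by_cases hy : truncParaboloid y = 0
    · simp [hy]
    have hy1 := norm_le_one_of_truncParaboloid_ne_zero hy
    refine mul_le_mul_of_nonneg_right ?_ (truncParaboloid_nonneg y)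
    have hr' : |r| ≤ |s| + 1 := by
      rw [Metric.mem_ball, Real.dist_eq] at hr
      linarith [abs_sub_abs_le_abs_sub r s]
    have hb := hC (x + r • y) (by
      rw [Metric.mem_closedBall, dist_eq_norm, add_sub_cancel_left, norm_smul, Real.norm_eq_abs]
      nlinarith [norm_nonneg y, abs_nonneg r])
    calc ‖fderiv ℝ V (x + r • y) y‖ ≤ ‖fderiv ℝ V (x + r • y)‖ * ‖y‖ :=
          ContinuousLinearMap.le_opNorm _ _
      _ ≤ C * 1 := by
          gcongr
          exact (norm_nonneg _).trans hb
      _ = C := mul_one C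
  · have h1 : HasDerivAt (fun r : ℝ => x + r • y) y r := by
      simpa using ((hasDerivAt_id r).smul_const y).const_add x
    exact (((hV.differentiable two_ne_zero _).hasFDerivAt.comp_hasDerivAt r h1)).mul_const _

lemma abs_weightedMean_sub_le {V : E → ℝ} (hV : ContDiff ℝ 2 V) {ℓ : ℝ≥0}
    (hℓ : LipschitzWith ℓ (Δ V)) :
    ∃ D, 0 ≤ D ∧ ∀ (x : E) (s : ℝ), 0 ≤ s →
      |weightedMean V s x - V x * ∫ y : E, truncParaboloid y| ≤ D * s ^ 2 * (1 + ‖x‖ + s) := by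
  set κ := ∫ y : E, truncParaboloid y ^ 2
  have hκ : 0 ≤ κ := integral_nonneg fun y => sq_nonneg _
  refine ⟨(|Δ V 0| + ℓ) * κ, by positivity, fun x s hs => ?_⟩
  have h := (convex_Icc (0 : ℝ) s).norm_image_sub_le_of_norm_hasDerivWithin_le
    (C := s * ((|Δ V 0| + ℓ) * (1 + ‖x‖ + s) * κ))
    (fun r _ => (hasDerivAt_weightedMean hV x r).hasDerivWithinAt) (fun r hr => ?_)
    (Set.left_mem_Icc.2 hs) (Set.right_mem_Icc.2 hs)
  · rw [weightedMean_zero, Real.norm_eq_abs, sub_zero, Real.norm_of_nonneg hs] at h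
    refine h.trans (le_of_eq ?_)
    ring
  · rw [norm_mul, Real.norm_of_nonneg (by linarith [hr.1]), Real.norm_eq_abs]
    refine mul_le_mul (by linarith [hr.1, hr.2])
      (abs_integral_mul_truncParaboloid_sq_le fun y hy => ?_) (abs_nonneg _) hs
    refine (abs_laplacian_le hℓ _).trans ?_
    have : ‖x + r • y‖ ≤ ‖x‖ + s := by
      refine (norm_add_le _ _).trans ?_
      rw [norm_smul, Real.norm_of_nonneg hr.1]
      nlinarith [hr.1, hr.2, norm_nonneg y]
    have h2 : 1 + ‖x + r • y‖ ≤ 1 + ‖x‖ + s := by linarith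
    gcongr

/-- Comparing two centres before integrating in the scale leaves only differences of `ΔV`, so the
error is linear in `‖h‖` and uniform in `x`. This is what makes a gradient bound possible. -/
lemma abs_weightedMean_sub_sub_le {V : E → ℝ} (hV : ContDiff ℝ 2 V) {ℓ : ℝ≥0}
    (hℓ : LipschitzWith ℓ (Δ V)) :
    ∃ D, 0 ≤ D ∧ ∀ x h : E,
      |(weightedMean V 1 (x + h) - weightedMean V 1 x)
        - (V (x + h) - V x) * ∫ y : E, truncParaboloid y| ≤ D * ‖h‖ := by
  set κ := ∫ y : E, truncParaboloid y ^ 2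
  have hκ : 0 ≤ κ := integral_nonneg fun y => sq_nonneg _
  refine ⟨ℓ * κ, by positivity, fun x h => ?_⟩
  have key := (convex_Icc (0 : ℝ) 1).norm_image_sub_le_of_norm_hasDerivWithin_le
    (C := 1 * (ℓ * ‖h‖ * κ))
    (fun r _ => ((hasDerivAt_weightedMean hV (x + h) r).sub
      (hasDerivAt_weightedMean hV x r)).hasDerivWithinAt) (fun r hr => ?_)
    (Set.left_mem_Icc.2 zero_le_one) (Set.right_mem_Icc.2 zero_le_one)
  · simp only [Pi.sub_apply, weightedMean_zero, Real.norm_eq_abs, sub_zero, abs_one] at key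
    rw [sub_mul]
    refine key.trans (le_of_eq ?_)
    ring
  · have hc : ∀ z, Continuous fun y => Δ V (z + r • y) := fun z => by
      have := hℓ.continuous
      fun_prop
    rw [← mul_sub, ← integral_sub (integrable_mul_truncParaboloid_sq (hc _))
      (integrable_mul_truncParaboloid_sq (hc _))]
    simp_rw [← sub_mul]
    rw [norm_mul, Real.norm_of_nonneg (by linarith [hr.1]), Real.norm_eq_abs]
    refine mul_le_mul (by linarith [hr.1, hr.2])
      (abs_integral_mul_truncParaboloid_sq_le fun y _ => ?_) (abs_nonneg _) zero_le_one
    have := hℓ.dist_le_mul (x + h + r • y) (x + r • y)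
    rwa [Real.dist_eq, dist_eq_norm, add_sub_add_right_eq_sub, add_sub_cancel_left] at this

lemma exists_neg_mul_one_add_norm_le {V : E → ℝ} (hV : ContDiff ℝ 2 V) {ℓ : ℝ≥0}
    (hℓ : LipschitzWith ℓ (Δ V)) (hint : Integrable (fun x => Real.exp (-V x)) volume) :
    ∃ A, 0 ≤ A ∧ ∀ x, -(A * (1 + ‖x‖)) ≤ V x := by
  obtain ⟨D, hD, hDx⟩ := abs_weightedMean_sub_le hV hℓ
  set c := ∫ y : E, truncParaboloid y
  have hc : 0 < c := integral_truncParaboloid_pos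
  set I := ∫ x, Real.exp (-V x)
  have hI : 0 ≤ I := integral_nonneg fun _ => (Real.exp_pos _).le
  refine ⟨(I + 2 * D) / c, by positivity, fun x => ?_⟩
  have h1 : -I ≤ weightedMean V 1 x := by
    have e : I = ∫ y, Real.exp (-V (x + (1 : ℝ) • y)) := by
      simp_rw [one_smul]
      exact (integral_add_left_eq_self (fun y => Real.exp (-V y)) x).symm
    rw [e, ← integral_neg]
    -- Pointwise, `V ≥ 1 - exp (-V) ≥ -exp (-V)`, and the cutoff lies in `[0, 1]`.
    refine integral_mono (by simpa using (hint.comp_add_left x).neg)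
      (integrable_weightedMean hV.continuous 1 x) fun y => ?_
    have h2 := Real.add_one_le_exp (-V (x + (1 : ℝ) • y))
    have h3 := Real.exp_pos (-V (x + (1 : ℝ) • y))
    have h4 := truncParaboloid_nonneg y
    have h5 := truncParaboloid_le_one y
    show -Real.exp _ ≤ _
    nlinarith
  have h2 := abs_le.1 (hDx x 1 zero_le_one)
  rw [div_mul_eq_mul_div, ← neg_div, div_le_iff₀ hc]
  nlinarith [norm_nonneg x]

/-- For a nonnegative integrand it is enough to compare weights. The ball of radius `R` about `x`
sits inside the ball of radius `2R` about `0`, where the cutoff at scale `4R` is at least `1 - 1/4`;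
hence the `4/3`. The power of `4` is the Jacobian between the two scales. -/
lemma weightedMean_le_weightedMean_zero {U : E → ℝ} (hU : Continuous U) {R : ℝ} (hR : 0 < R)
    (hU0 : ∀ z, ‖z‖ ≤ 4 * R → 0 ≤ U z) {x : E} (hx : ‖x‖ ≤ R) :
    weightedMean U R x ≤ 4 / 3 * 4 ^ Module.finrank ℝ E * weightedMean U (4 * R) 0 := by
  have hcs : weightedMean U (4 * R) 0 = |((4 : ℝ)⁻¹) ^ Module.finrank ℝ E| *
      ∫ y, U (x + R • y) * truncParaboloid ((4 : ℝ)⁻¹ • (R⁻¹ • x + y)) := by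
    have h1 := Measure.integral_comp_smul (volume : Measure E)
      (fun y => U (x + R • (y - R⁻¹ • x)) * truncParaboloid ((4 : ℝ)⁻¹ • y)) 4
    have h2 := integral_sub_right_eq_self (μ := (volume : Measure E))
      (fun y => U (x + R • y) * truncParaboloid ((4 : ℝ)⁻¹ • (R⁻¹ • x + y))) (R⁻¹ • x)
    simp only [add_sub_cancel] at h2
    rw [h2, smul_eq_mul] at h1
    rw [inv_pow, ← h1, weightedMean]
    congr 1
    ext y
    congr 2
    · rw [zero_add, smul_sub, smul_smul, smul_smul, mul_inv_cancel₀ hR.ne', one_smul,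
        add_sub_cancel, mul_comm]
    · simp [smul_smul]
  have hi : Integrable (fun y => U (x + R • y) * truncParaboloid ((4 : ℝ)⁻¹ • (R⁻¹ • x + y)))
      volume := by
    refine integrable_mul_of_hasCompactSupport (hU.comp (by fun_prop))
      (continuous_truncParaboloid.comp (by fun_prop)) ?_
    refine HasCompactSupport.intro (isCompact_closedBall (-(R⁻¹ • x)) 4) fun y hy => ?_
    rw [Metric.mem_closedBall, dist_eq_norm, not_le, sub_neg_eq_add] at hy
    apply truncParaboloid_eq_zero
    rw [norm_smul, norm_inv, Real.norm_ofNat, add_comm]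
    linarith
  rw [hcs, abs_of_nonneg (by positivity), inv_pow]
  have hcancel : ∀ b : ℝ, 4 / 3 * 4 ^ Module.finrank ℝ E * ((4 ^ Module.finrank ℝ E)⁻¹ * b)
      = 4 / 3 * b := fun b => by field_simp
  rw [hcancel, ← integral_const_mul]
  refine integral_mono (integrable_weightedMean hU R x) (hi.const_mul _) fun y => ?_
  have hsc : ‖(4 : ℝ)⁻¹ • (R⁻¹ • x + y)‖ * (4 * R) = ‖x + R • y‖ := by
    have : x + R • y = R • (R⁻¹ • x + y) := by
      rw [smul_add, smul_smul, mul_inv_cancel₀ hR.ne', one_smul]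
    rw [this, norm_smul, norm_smul, norm_inv, Real.norm_ofNat, Real.norm_of_nonneg hR.le]
    ring
  by_cases h0 : truncParaboloid ((4 : ℝ)⁻¹ • (R⁻¹ • x + y)) = 0
  · by_cases hy : truncParaboloid y = 0
    · simp only [h0, hy, mul_zero, le_refl]
    · exfalso
      have hy1 := norm_le_one_of_truncParaboloid_ne_zero hy
      have h3 : ‖x + R • y‖ ≤ 2 * R := by
        refine (norm_add_le _ _).trans ?_
        rw [norm_smul, Real.norm_of_nonneg hR.le]
        nlinarith
      have h4 : ‖(4 : ℝ)⁻¹ • (R⁻¹ • x + y)‖ ≤ 1 / 2 := by nlinarith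
      rw [truncParaboloid_of_norm_le (by linarith)] at h0
      nlinarith [norm_nonneg ((4 : ℝ)⁻¹ • (R⁻¹ • x + y))]
  · have h1 := norm_le_one_of_truncParaboloid_ne_zero h0
    have hU1 : 0 ≤ U (x + R • y) := hU0 _ (by rw [← hsc]; nlinarith)
    have h5 : truncParaboloid y ≤ 4 / 3 * truncParaboloid ((4 : ℝ)⁻¹ • (R⁻¹ • x + y)) := by
      by_cases hy : truncParaboloid y = 0
      · rw [hy]
        exact mul_nonneg (by norm_num) (truncParaboloid_nonneg _)
      have hy1 := norm_le_one_of_truncParaboloid_ne_zero hy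
      have h3 : ‖x + R • y‖ ≤ 2 * R := by
        refine (norm_add_le _ _).trans ?_
        rw [norm_smul, Real.norm_of_nonneg hR.le]
        nlinarith
      have h4 : ‖(4 : ℝ)⁻¹ • (R⁻¹ • x + y)‖ ≤ 1 / 2 := by nlinarith
      rw [truncParaboloid_of_norm_le h1]
      have := truncParaboloid_le_one y
      nlinarith [norm_nonneg ((4 : ℝ)⁻¹ • (R⁻¹ • x + y))]
    show U (x + R • y) * _ ≤ 4 / 3 * (U (x + R • y) * _)
    nlinarith

lemma weightedMean_add_const {V : E → ℝ} (hV : Continuous V) (a s : ℝ) (x : E) :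
    weightedMean (fun z => V z + a) s x
      = weightedMean V s x + a * ∫ y : E, truncParaboloid y := by
  simp only [weightedMean, add_mul]
  rw [integral_add (integrable_weightedMean hV s x)
    (integrable_mul_of_hasCompactSupport continuous_const continuous_truncParaboloid
      hasCompactSupport_truncParaboloid), integral_const_mul]

/-- If `exp (-V)` is integrable and `ΔV` is Lipschitz, then `V` grows at most cubically. -/
lemma exists_abs_le_mul_one_add_norm_pow {V : E → ℝ} (hV : ContDiff ℝ 2 V) {ℓ : ℝ≥0}
    (hℓ : LipschitzWith ℓ (Δ V)) (hint : Integrable (fun x => Real.exp (-V x)) volume) :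
    ∃ C, 0 ≤ C ∧ ∀ x, |V x| ≤ C * (1 + ‖x‖) ^ 3 := by
  obtain ⟨D, hD, hDx⟩ := abs_weightedMean_sub_le hV hℓ
  obtain ⟨A, hA, hAx⟩ := exists_neg_mul_one_add_norm_le hV hℓ hint
  set c := ∫ y : E, truncParaboloid y
  have hc : 0 < c := integral_truncParaboloid_pos
  set k : ℝ := 4 / 3 * 4 ^ Module.finrank ℝ E
  have hk : 0 ≤ k := by positivity
  -- With `R = 1 + ‖x‖`, the shift `5AR` makes `V` nonnegative on the ball of radius `4R`. The `80`
  -- comes from `(4R)²(R + 4R)`, and `2D` from the error of the average at `x` at scale `R`.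
  refine ⟨(k * (80 * D + |V 0| * c + 5 * A * c) + 2 * D) / c + A, by positivity, fun x => ?_⟩
  set R := 1 + ‖x‖ with hRdef
  have hR : 1 ≤ R := by linarith [norm_nonneg x]
  have hR0 : 0 ≤ R := by linarith
  have hR3 : R ≤ R ^ 3 := le_self_pow₀ hR (by norm_num)
  have h13 : 1 ≤ R ^ 3 := one_le_pow₀ hR
  rw [abs_le]
  constructor
  · have h1 := hAx x
    have h2 : A * R ≤ A * R ^ 3 := by gcongr
    have h3 : 0 ≤ (k * (80 * D + |V 0| * c + 5 * A * c) + 2 * D) / c * R ^ 3 := by positivity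
    rw [add_mul]
    linarith
  · have h1 := weightedMean_le_weightedMean_zero (U := fun z => V z + 5 * A * R)
      (hV.continuous.add continuous_const) (R := R) (by linarith) (fun z hz => by
        have := hAx z
        have h2 : A * (1 + ‖z‖) ≤ A * (5 * R) := by
          gcongr
          linarith
        show 0 ≤ V z + 5 * A * R
        linarith) (x := x) (by linarith)
    rw [weightedMean_add_const hV.continuous, weightedMean_add_const hV.continuous] at h1
    change weightedMean V R x + 5 * A * R * c ≤ k * (weightedMean V (4 * R) 0 + 5 * A * R * c) at h1
    have h2 := abs_le.1 (hDx x R hR0)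
    have h3 := abs_le.1 (hDx 0 (4 * R) (by linarith))
    rw [norm_zero, add_zero] at h3
    have h4 : weightedMean V (4 * R) 0 + 5 * A * R * c
        ≤ (80 * D + |V 0| * c + 5 * A * c) * R ^ 3 := by
      have e1 : D * (4 * R) ^ 2 * (1 + 4 * R) ≤ 80 * D * R ^ 3 := by
        have : D * (4 * R) ^ 2 * (1 + 4 * R) ≤ D * (4 * R) ^ 2 * (R + 4 * R) := by gcongr
        refine this.trans (le_of_eq ?_)
        ring
      have e2 : V 0 * c ≤ |V 0| * c * R ^ 3 := by
        have := le_abs_self (V 0)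
        calc V 0 * c ≤ |V 0| * c := by gcongr
          _ ≤ |V 0| * c * R ^ 3 := le_mul_of_one_le_right (by positivity) h13
      have e3 : 5 * A * R * c ≤ 5 * A * c * R ^ 3 := by
        calc 5 * A * R * c = 5 * A * c * R := by ring
          _ ≤ 5 * A * c * R ^ 3 := by gcongr
      nlinarith
    have h5 : V x * c ≤ (k * (80 * D + |V 0| * c + 5 * A * c) + 2 * D) * R ^ 3 := by
      have e1 := h1.trans (mul_le_mul_of_nonneg_left h4 hk)
      have e2 : 0 ≤ 5 * A * R * c := by positivity
      have e3 : D * R ^ 2 * (1 + ‖x‖ + R) = 2 * D * R ^ 3 := by rw [← hRdef]; ring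
      rw [e3] at h2
      nlinarith
    have h6 : V x ≤ (k * (80 * D + |V 0| * c + 5 * A * c) + 2 * D) / c * R ^ 3 := by
      rw [div_mul_eq_mul_div, le_div_iff₀ hc]
      exact h5
    rw [add_mul]
    have : 0 ≤ A * R ^ 3 := by positivity
    linarith

/-- If `exp (-V)` is integrable and `ΔV` is Lipschitz, then `∇V` grows at most cubically. -/
lemma exists_norm_fderiv_le_mul_one_add_norm_pow {V : E → ℝ} (hV : ContDiff ℝ 2 V) {ℓ : ℝ≥0}
    (hℓ : LipschitzWith ℓ (Δ V)) (hint : Integrable (fun x => Real.exp (-V x)) volume) :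
    ∃ C, 0 ≤ C ∧ ∀ x, ‖fderiv ℝ V x‖ ≤ C * (1 + ‖x‖) ^ 3 := by
  obtain ⟨D, hD, hDx⟩ := abs_weightedMean_sub_sub_le hV hℓ
  obtain ⟨C, hC, hCx⟩ := exists_abs_le_mul_one_add_norm_pow hV hℓ hint
  set c := ∫ y : E, truncParaboloid y
  have hc : 0 < c := integral_truncParaboloid_pos
  set v := (volume : Measure E).real (Metric.closedBall 0 2)
  have hv : 0 ≤ v := measureReal_nonneg
  -- A local Lipschitz bound controls the derivative. Here `54 = 3³ · 2`: the cubic bound on `V` at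
  -- points of norm at most `‖x‖ + 2`, times the Lipschitz constant of the cutoff. For `‖h‖ < 1`
  -- both translated cutoffs live in the ball of radius `2`, of volume `v`.
  refine ⟨(54 * C * v + D) / c, by positivity, fun x => norm_fderiv_le_of_lip' ℝ (by positivity) ?_⟩
  filter_upwards [Metric.ball_mem_nhds x one_pos] with z hz
  obtain ⟨h, rfl⟩ : ∃ h, z = x + h := ⟨z - x, by abel⟩
  rw [Metric.mem_ball, dist_eq_norm, add_sub_cancel_left] at hz
  rw [add_sub_cancel_left, Real.norm_eq_abs]
  set R := 1 + ‖x‖ with hRdef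
  have hR : 1 ≤ R := by linarith [norm_nonneg x]
  have h1 : |weightedMean V 1 (x + h) - weightedMean V 1 x| ≤ 54 * C * v * R ^ 3 * ‖h‖ := by
    -- The translation is moved onto the cutoff, so that only the size of `V`, not its regularity,
    -- enters.
    have e1 : weightedMean V 1 (x + h) = ∫ y, V (x + (1 : ℝ) • y) * truncParaboloid (y - h) := by
      have := integral_add_right_eq_self (μ := (volume : Measure E))
        (fun y => V (x + (1 : ℝ) • y) * truncParaboloid (y - h)) h
      rw [← this, weightedMean]
      simp [add_assoc, add_comm h]
    have i1 : Integrable (fun y => V (x + (1 : ℝ) • y) * truncParaboloid (y - h)) volume := by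
      have := (integrable_weightedMean hV.continuous 1 (x + h)).comp_sub_right h
      simpa using this
    rw [e1, weightedMean, ← integral_sub i1 (integrable_weightedMean hV.continuous 1 x),
      ← Real.norm_eq_abs]
    have hb : ∀ y, ‖V (x + (1 : ℝ) • y) * truncParaboloid (y - h)
        - V (x + (1 : ℝ) • y) * truncParaboloid y‖
        ≤ (Metric.closedBall (0 : E) 2).indicator (fun _ => 54 * C * R ^ 3 * ‖h‖) y := fun y => by
      by_cases hy : y ∈ Metric.closedBall (0 : E) 2
      · rw [Set.indicator_of_mem hy]
        rw [Metric.mem_closedBall, dist_zero_right] at hy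
        rw [← mul_sub, norm_mul, Real.norm_eq_abs, Real.norm_eq_abs]
        have t1 := abs_truncParaboloid_sub_le (y - h) y
        rw [sub_sub_cancel_left, norm_neg] at t1
        have t2 : |V (x + (1 : ℝ) • y)| ≤ C * (3 * R) ^ 3 := by
          refine (hCx _).trans ?_
          rw [one_smul]
          have := norm_add_le x y
          have : 1 + ‖x + y‖ ≤ 3 * R := by linarith
          gcongr
        calc _ ≤ C * (3 * R) ^ 3 * (2 * ‖h‖) := by gcongr
          _ = _ := by ring
      · rw [Set.indicator_of_notMem hy]
        rw [Metric.mem_closedBall, dist_zero_right, not_le] at hy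
        have := norm_sub_norm_le y h
        rw [truncParaboloid_eq_zero (y := y) (by linarith),
          truncParaboloid_eq_zero (y := y - h) (by linarith)]
        simp
    refine (norm_integral_le_of_norm_le ?_ (.of_forall hb)).trans (le_of_eq ?_)
    · exact (integrable_indicator_iff measurableSet_closedBall).2
        (integrableOn_const (isCompact_closedBall _ _).measure_lt_top.ne)
    · rw [integral_indicator_const _ measurableSet_closedBall, smul_eq_mul]
      ring
  have h2 := hDx x h
  have h3 : |V (x + h) - V x| * c ≤ (54 * C * v + D) * R ^ 3 * ‖h‖ := by
    rw [show |V (x + h) - V x| * c = |(V (x + h) - V x) * c| by rw [abs_mul, abs_of_pos hc]]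
    have h4 : D * ‖h‖ ≤ D * R ^ 3 * ‖h‖ :=
      mul_le_mul_of_nonneg_right (le_mul_of_one_le_right hD (one_le_pow₀ hR)) (norm_nonneg h)
    have h5 := abs_sub_abs_le_abs_sub ((V (x + h) - V x) * c)
      (weightedMean V 1 (x + h) - weightedMean V 1 x)
    rw [abs_sub_comm] at h2
    linarith
  calc |V (x + h) - V x| ≤ ((54 * C * v + D) * R ^ 3 * ‖h‖) / c := by rwa [le_div_iff₀ hc]
    _ = _ := by ring

end Growth

/-! ### Densities and polynomial moments of Gaussian measures. -/

section GaussianDensity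

variable {E : Type*} [NormedAddCommGroup E] [InnerProductSpace ℝ E]

/-- The log-density, up to an additive constant, of the image of the standard Gaussian measure
under the affine map `x ↦ m + A x`. -/
noncomputable def gaussianLogWeight (m : E) (A : E ≃L[ℝ] E) (x : E) : ℝ :=
  -‖A.symm (x - m)‖ ^ 2 / 2

lemma gaussianLogWeight_add_apply (m : E) (A : E ≃L[ℝ] E) (z : E) :
    gaussianLogWeight m A (m + A z) = -‖z‖ ^ 2 / 2 := by
  simp [gaussianLogWeight]

lemma continuous_gaussianLogWeight (m : E) (A : E ≃L[ℝ] E) :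
    Continuous (gaussianLogWeight m A) := by
  unfold gaussianLogWeight
  fun_prop

lemma abs_det_pos (A : E ≃L[ℝ] E) : 0 < |LinearMap.det (A : E →ₗ[ℝ] E)| :=
  abs_pos.2 A.toLinearEquiv.isUnit_det'.ne_zero

variable [FiniteDimensional ℝ E]

lemma hasGradientAt_gaussianLogWeight {m : E} {A : E ≃L[ℝ] E} {w : E → E}
    (hw : ∀ x v, inner ℝ (w x) v = inner ℝ (A.symm (x - m)) (A.symm v)) (x : E) :
    HasGradientAt (gaussianLogWeight m A) (-w x) x := by
  rw [hasGradientAt_iff_hasFDerivAt]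
  have h1 : HasFDerivAt (fun x => A.symm (x - m)) (A.symm : E →L[ℝ] E) x :=
    A.symm.hasFDerivAt.comp x ((hasFDerivAt_id x).sub_const m)
  have h2 := (hasStrictFDerivAt_norm_sq (F := E) (A.symm (x - m))).hasFDerivAt.comp x h1
  have h3 := h2.const_mul (-1 / 2 : ℝ)
  refine (h3.congr_fderiv ?_).congr_of_eventuallyEq (.of_forall fun y => ?_)
  · ext v
    simp only [smul_apply, ContinuousLinearMap.comp_apply,
      InnerProductSpace.toDual_apply_apply, inner_neg_left, hw, innerSL_apply_apply,
      ContinuousLinearEquiv.coe_coe, smul_eq_mul, nsmul_eq_mul]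
    push_cast
    ring
  · simp only [gaussianLogWeight, Function.comp_apply]
    ring

variable [MeasurableSpace E] [BorelSpace E]

lemma integrable_exp_neg_norm_sq_div_two :
    Integrable (fun x : E => Real.exp (-‖x‖ ^ 2 / 2)) volume := by
  have h := (GaussianFourier.integrable_cexp_neg_mul_sq_norm_add (b := 1 / 2) (V := E)
    (by norm_num) 0 0).norm
  refine h.congr (.of_forall fun x => ?_)
  beta_reduce
  rw [Complex.norm_exp, show -(1 / 2) * (‖x‖ : ℂ) ^ 2 + 0 * ((inner ℝ 0 x : ℝ) : ℂ)
    = ((-‖x‖ ^ 2 / 2 : ℝ) : ℂ) by push_cast; ring, Complex.ofReal_re]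

lemma stdGaussian_eq_tilted :
    stdGaussian E = (volume : Measure E).tilted (fun x => -‖x‖ ^ 2 / 2) := by
  -- The Fourier integral identifies the characteristic function; its value at `t = 0` is the
  -- normalising constant, which therefore never has to be simplified.
  have hJ : ∀ t : E, ∫ x : E, Complex.exp (((-‖x‖ ^ 2 / 2 : ℝ) : ℂ) + (inner ℝ x t : ℝ) * Complex.I)
      = (Real.pi / (1 / 2) : ℂ) ^ ((Module.finrank ℝ E : ℂ) / 2)
        * Complex.exp (-‖t‖ ^ 2 / 2) := fun t => by
    have h := GaussianFourier.integral_cexp_neg_mul_sq_norm_add (b := 1 / 2) (V := E)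
      (by norm_num) Complex.I t
    rw [Complex.I_sq] at h
    rw [show (-‖t‖ ^ 2 / 2 : ℂ) = -1 * ‖t‖ ^ 2 / (4 * (1 / 2)) by ring, ← h]
    congr 1
    ext x
    congr 1
    push_cast
    rw [real_inner_comm]
    ring
  have hZ : ((∫ x : E, Real.exp (-‖x‖ ^ 2 / 2) : ℝ) : ℂ)
      = (Real.pi / (1 / 2) : ℂ) ^ ((Module.finrank ℝ E : ℂ) / 2) := by
    have h := hJ 0
    simp only [inner_zero_right, Complex.ofReal_zero, zero_mul, add_zero, norm_zero, ne_eq,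
      OfNat.ofNat_ne_zero, not_false_eq_true, zero_pow, neg_zero, zero_div, Complex.exp_zero,
      mul_one] at h
    rw [← h, ← integral_complex_ofReal]
    simp
  have hZ0 : (∫ x : E, Real.exp (-‖x‖ ^ 2 / 2)) ≠ 0 :=
    (integral_exp_pos integrable_exp_neg_norm_sq_div_two).ne'
  have := isProbabilityMeasure_tilted (integrable_exp_neg_norm_sq_div_two (E := E))
  refine Measure.ext_of_charFun (funext fun t => ?_)
  rw [charFun_stdGaussian, charFun_apply, integral_tilted]
  have e : ∀ x : E, (Real.exp (-‖x‖ ^ 2 / 2) / ∫ x : E, Real.exp (-‖x‖ ^ 2 / 2)) •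
      Complex.exp ((inner ℝ x t : ℝ) * Complex.I)
      = ((∫ x : E, Real.exp (-‖x‖ ^ 2 / 2) : ℝ) : ℂ)⁻¹ *
        Complex.exp (((-‖x‖ ^ 2 / 2 : ℝ) : ℂ) + (inner ℝ x t : ℝ) * Complex.I) := fun x => by
    rw [Complex.exp_add, Complex.real_smul, Complex.ofReal_div, Complex.ofReal_exp]
    ring
  simp_rw [e]
  rw [integral_const_mul, hJ, ← hZ, inv_mul_cancel_left₀ (Complex.ofReal_ne_zero.2 hZ0)]

lemma integral_comp_symm_sub {F : Type*} [NormedAddCommGroup F] [NormedSpace ℝ F] (g : E → F)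
    (m : E) (A : E ≃L[ℝ] E) :
    ∫ x, g (A.symm (x - m)) = |LinearMap.det (A : E →ₗ[ℝ] E)| • ∫ x, g x := by
  rw [integral_sub_right_eq_self (fun x => g (A.symm x)) m]
  have hdet : LinearMap.det (A.symm : E →ₗ[ℝ] E) ≠ 0 :=
    A.symm.toLinearEquiv.isUnit_det'.ne_zero
  have hmul : LinearMap.det (A : E →ₗ[ℝ] E) * LinearMap.det (A.symm : E →ₗ[ℝ] E) = 1 :=
    A.toLinearEquiv.det_mul_det_symm
  have hmap := Measure.map_linearMap_addHaar_eq_smul_addHaar (volume : Measure E) hdet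
  have h := integral_map_equiv (μ := (volume : Measure E))
    A.symm.toHomeomorph.toMeasurableEquiv g
  calc ∫ x, g (A.symm x) = ∫ y, g y ∂(Measure.map (A.symm : E →ₗ[ℝ] E) volume) := h.symm
    _ = _ := by
      rw [hmap, integral_smul_measure, ENNReal.toReal_ofReal (abs_nonneg _),
        inv_eq_of_mul_eq_one_left hmul]

lemma integral_exp_gaussianLogWeight (m : E) (A : E ≃L[ℝ] E) :
    ∫ x, Real.exp (gaussianLogWeight m A x)
      = |LinearMap.det (A : E →ₗ[ℝ] E)| * ∫ x : E, Real.exp (-‖x‖ ^ 2 / 2) :=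
  integral_comp_symm_sub (fun x : E => Real.exp (-‖x‖ ^ 2 / 2)) m A

lemma integrable_exp_gaussianLogWeight (m : E) (A : E ≃L[ℝ] E) :
    Integrable (fun x => Real.exp (gaussianLogWeight m A x)) volume := by
  refine Integrable.of_integral_ne_zero ?_
  rw [integral_exp_gaussianLogWeight]
  exact (mul_pos (abs_det_pos A) (integral_exp_pos integrable_exp_neg_norm_sq_div_two)).ne'

/-- The density of a nondegenerate Gaussian measure. -/
lemma stdGaussian_map_affine (m : E) (A : E ≃L[ℝ] E) :
    (stdGaussian E).map (fun x => m + A x)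
      = (volume : Measure E).tilted (gaussianLogWeight m A) := by
  have := isProbabilityMeasure_tilted (integrable_exp_gaussianLogWeight m A)
  have : IsProbabilityMeasure ((stdGaussian E).map (fun x => m + A x)) :=
    Measure.isProbabilityMeasure_map (Measurable.aemeasurable (by fun_prop))
  refine Measure.ext_of_charFun (funext fun t => ?_)
  rw [charFun_apply, charFun_apply, integral_map (by fun_prop) (by fun_prop),
    stdGaussian_eq_tilted, integral_tilted, integral_tilted, integral_exp_gaussianLogWeight]
  have h := integral_comp_symm_sub (fun z : E => (Real.exp (-‖z‖ ^ 2 / 2) /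
    (|LinearMap.det (A : E →ₗ[ℝ] E)| * ∫ x : E, Real.exp (-‖x‖ ^ 2 / 2))) •
      Complex.exp ((inner ℝ (m + A z) t : ℝ) * Complex.I)) m A
  simp only [ContinuousLinearEquiv.apply_symm_apply, add_sub_cancel] at h
  refine Eq.trans ?_ h.symm
  rw [← integral_smul]
  congr 1
  ext z
  rw [smul_smul]
  congr 1
  have := (abs_det_pos A).ne'
  field_simp

lemma integrable_of_norm_le_mul_one_add_norm_pow {F : Type*} [NormedAddCommGroup F]
    {μ : Measure E} [IsGaussian μ] {f : E → F} (hf : AEStronglyMeasurable f μ) {C : ℝ} {n : ℕ}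
    (hC : ∀ x, ‖f x‖ ≤ C * (1 + ‖x‖) ^ n) : Integrable f μ := by
  have h0 : MemLp (fun x : E => x) (n : ℝ≥0∞) μ :=
    IsGaussian.memLp_id μ n (ENNReal.natCast_ne_top n)
  have h1 : MemLp (fun x : E => 1 + ‖x‖) (n : ℝ≥0∞) μ := (memLp_const (1 : ℝ)).add h0.norm
  refine (h1.integrable_norm_pow'.const_mul C).mono' hf (.of_forall fun x => ?_)
  rw [Real.norm_of_nonneg (by positivity)]
  exact hC x

end GaussianDensity

/-! ### Divergence from a Gaussian to the target. -/

section KullbackLeibler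

lemma toReal_klDiv_tilted {α : Type*} {mα : MeasurableSpace α} {ν : Measure α} [SigmaFinite ν]
    [NeZero ν] {f g : α → ℝ} (hf : Integrable (fun x => Real.exp (f x)) ν)
    (hg : Integrable (fun x => Real.exp (g x)) ν) (hfi : Integrable f (ν.tilted f))
    (hgi : Integrable g (ν.tilted f)) :
    InformationTheory.klDiv (ν.tilted f) (ν.tilted g) ≠ ∞ ∧
    (InformationTheory.klDiv (ν.tilted f) (ν.tilted g)).toReal
      = ∫ x, f x ∂(ν.tilted f) - Real.log (∫ x, Real.exp (f x) ∂ν) - ∫ x, g x ∂(ν.tilted f)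
        + Real.log (∫ x, Real.exp (g x) ∂ν) := by
  have := isProbabilityMeasure_tilted hf
  have := isProbabilityMeasure_tilted hg
  have hac : ν.tilted f ≪ ν := tilted_absolutelyContinuous ν f
  have hac2 : ν.tilted f ≪ ν.tilted g := hac.trans (absolutelyContinuous_tilted hg)
  have hllr : llr (ν.tilted f) ν =ᵐ[ν.tilted f]
      fun x => f x - Real.log (∫ x, Real.exp (f x) ∂ν) :=
    hac.ae_le (log_rnDeriv_tilted_left_self hf)
  have hi : Integrable (llr (ν.tilted f) ν) (ν.tilted f) :=
    (integrable_congr hllr).2 (hfi.sub (integrable_const _))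
  have hi2 := integrable_llr_tilted_right hac hgi hi hg
  refine ⟨InformationTheory.klDiv_ne_top hac2 hi2, ?_⟩
  rw [InformationTheory.toReal_klDiv hac2 hi2, integral_llr_tilted_right hac hgi hg hi,
    integral_congr_ae hllr, integral_sub hfi (integrable_const _)]
  simp

variable {E : Type*} [NormedAddCommGroup E] [InnerProductSpace ℝ E] [FiniteDimensional ℝ E]
  [MeasurableSpace E] [BorelSpace E]

instance isGaussian_tilted_gaussianLogWeight (m : E) (A : E ≃L[ℝ] E) :
    IsGaussian ((volume : Measure E).tilted (gaussianLogWeight m A)) := by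
  have h : (fun x => m + A x) = (fun x => m + x) ∘ (A : E →L[ℝ] E) := rfl
  rw [← stdGaussian_map_affine, h, ← Measure.map_map (measurable_const_add m) (by fun_prop)]
  infer_instance

/-- After pulling back to the standard Gaussian, the quadratic log-weight integrates to a value
independent of `m` and `A`. The constant `a` collects it with both normalising constants, leaving an
explicit objective to differentiate. -/
lemma toReal_klDiv_gaussian {V : E → ℝ} (hV : Continuous V)
    (hint : Integrable (fun x => Real.exp (-V x)) volume) {C : ℝ} {n : ℕ}
    (hC : ∀ x, |V x| ≤ C * (1 + ‖x‖) ^ n) :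
    ∃ a : ℝ, ∀ (m : E) (A : E ≃L[ℝ] E),
      InformationTheory.klDiv ((stdGaussian E).map (fun x => m + A x))
        ((volume : Measure E).tilted fun x => -V x) ≠ ∞ ∧
      (InformationTheory.klDiv ((stdGaussian E).map (fun x => m + A x))
        ((volume : Measure E).tilted fun x => -V x)).toReal
        = a + ∫ z, V (m + A z) ∂(stdGaussian E)
          - Real.log |LinearMap.det (A : E →ₗ[ℝ] E)| := by
  refine ⟨∫ z, -‖z‖ ^ 2 / 2 ∂(stdGaussian E) - Real.log (∫ x : E, Real.exp (-‖x‖ ^ 2 / 2))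
    + Real.log (∫ x, Real.exp (-V x)), fun m A => ?_⟩
  have hmap : ∀ g : E → ℝ, Continuous g →
      ∫ x, g x ∂((volume : Measure E).tilted (gaussianLogWeight m A))
        = ∫ z, g (m + A z) ∂(stdGaussian E) := fun g hg => by
    rw [← stdGaussian_map_affine,
      integral_map (Measurable.aemeasurable (by fun_prop)) hg.aestronglyMeasurable]
  have hgi : Integrable (gaussianLogWeight m A)
      ((volume : Measure E).tilted (gaussianLogWeight m A)) := by
    rw [← stdGaussian_map_affine, integrable_map_measure
      (continuous_gaussianLogWeight m A).aestronglyMeasurable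
      (Measurable.aemeasurable (by fun_prop))]
    refine integrable_of_norm_le_mul_one_add_norm_pow (C := 1) (n := 2)
      (Continuous.aestronglyMeasurable
        ((continuous_gaussianLogWeight m A).comp (by fun_prop))) fun z => ?_
    rw [Function.comp_apply, gaussianLogWeight_add_apply, Real.norm_eq_abs, abs_div, abs_neg,
      abs_of_nonneg (sq_nonneg _), abs_two]
    nlinarith [norm_nonneg z]
  have hVi : Integrable (fun x => -V x)
      ((volume : Measure E).tilted (gaussianLogWeight m A)) :=
    integrable_of_norm_le_mul_one_add_norm_pow hV.neg.aestronglyMeasurable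
      (fun x => by rw [norm_neg]; exact hC x)
  rw [stdGaussian_map_affine]
  obtain ⟨h1, h2⟩ := toReal_klDiv_tilted (integrable_exp_gaussianLogWeight m A) hint hgi hVi
  refine ⟨h1, ?_⟩
  rw [h2, hmap _ (continuous_gaussianLogWeight m A), hmap (fun x => -V x) hV.neg, integral_neg,
    integral_exp_gaussianLogWeight, Real.log_mul (abs_det_pos A).ne'
      (integral_exp_pos integrable_exp_neg_norm_sq_div_two).ne']
  simp_rw [gaussianLogWeight_add_apply]
  ring

end KullbackLeibler

/-! ### Stein's identity. -/

section Stein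

variable {E : Type*} [NormedAddCommGroup E] [InnerProductSpace ℝ E] [FiniteDimensional ℝ E]
  [MeasurableSpace E] [BorelSpace E]

lemma integral_exp_mul_eq_mul_integral_tilted {α : Type*} {mα : MeasurableSpace α}
    {ν : Measure α} [NeZero ν] {f : α → ℝ} (hf : Integrable (fun x => Real.exp (f x)) ν)
    (g : α → ℝ) :
    ∫ x, Real.exp (f x) * g x ∂ν
      = (∫ x, Real.exp (f x) ∂ν) * ∫ x, g x ∂(ν.tilted f) := by
  rw [integral_tilted, ← integral_const_mul]
  congr 1
  ext x
  rw [smul_eq_mul]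
  have := (integral_exp_pos hf).ne'
  field_simp

/-- Green's identity is applied to the squared cutoff times the unnormalised Gaussian density. The
derivative falling on the cutoff gives the term with `r ^ 2`, the one falling on the density gives
the score `w`. -/
lemma integral_truncParaboloid_stein {V : E → ℝ} (hV : ContDiff ℝ 2 V) {m : E} {A : E ≃L[ℝ] E}
    {w : E → E} (hwc : Continuous w)
    (hw : ∀ x v, inner ℝ (w x) v = inner ℝ (A.symm (x - m)) (A.symm v)) {r : ℝ} (hr : 0 < r) :
    ∫ x, (4 * r ^ 2 * truncParaboloid (r • x) * fderiv ℝ V x x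
        + truncParaboloid (r • x) ^ 2 * fderiv ℝ V x (w x))
        ∂((volume : Measure E).tilted (gaussianLogWeight m A))
      = ∫ x, Δ V x * truncParaboloid (r • x) ^ 2
        ∂((volume : Measure E).tilted (gaussianLogWeight m A)) := by
  set f := gaussianLogWeight m A with hf
  have hfc : Continuous f := continuous_gaussianLogWeight m A
  have hβ := continuous_truncParaboloid (E := E)
  have hq : ∀ x, HasGradientAt (fun x => truncParaboloid (r • x) ^ 2 * Real.exp (f x))
      (-Real.exp (f x) • ((4 * r ^ 2 * truncParaboloid (r • x)) • x
        + truncParaboloid (r • x) ^ 2 • w x)) x := fun x => by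
    rw [hasGradientAt_iff_hasFDerivAt]
    refine ((hasGradientAt_truncParaboloid_smul_sq r x).hasFDerivAt.mul
      (hasGradientAt_gaussianLogWeight hw x).hasFDerivAt.exp).congr_fderiv ?_
    ext v
    simp only [add_apply, smul_apply,
      InnerProductSpace.toDual_apply_apply, inner_neg_left, inner_smul_left, smul_eq_mul,
      inner_add_left, conj_trivial]
    ring
  have hc : HasCompactSupport fun x => truncParaboloid (r • x) ^ 2 * Real.exp (f x) := by
    refine HasCompactSupport.intro (isCompact_closedBall 0 r⁻¹) fun y hy => ?_
    rw [Metric.mem_closedBall, dist_zero_right, not_le] at hy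
    rw [truncParaboloid_eq_zero, zero_pow two_ne_zero, zero_mul]
    rw [norm_smul, Real.norm_of_nonneg hr.le, mul_comm]
    exact ((inv_lt_iff_one_lt_mul₀ hr).1 hy).le
  have key := integral_fderiv_apply_gradient hV hq (by fun_prop) hc 0 1
  simp only [zero_add, one_smul, map_smul, map_add, smul_eq_mul, neg_mul, one_mul] at key
  rw [integral_neg, neg_inj] at key
  have e : ∀ x, Δ V x * (truncParaboloid (r • x) ^ 2 * Real.exp (f x))
      = Real.exp (f x) * (Δ V x * truncParaboloid (r • x) ^ 2) := fun x => by ring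
  simp_rw [e] at key
  have hi := integrable_exp_gaussianLogWeight m A
  rw [integral_exp_mul_eq_mul_integral_tilted hi, integral_exp_mul_eq_mul_integral_tilted hi]
    at key
  exact mul_left_cancel₀ (integral_exp_pos hi).ne' key

/-- Stein's identity for a potential with a gradient of polynomial growth. -/
lemma integral_fderiv_eq_integral_laplacian {V : E → ℝ} (hV : ContDiff ℝ 2 V) {m : E}
    {A : E ≃L[ℝ] E} {w : E → E} (hwc : Continuous w)
    (hw : ∀ x v, inner ℝ (w x) v = inner ℝ (A.symm (x - m)) (A.symm v))
    {C Cw L : ℝ} {n k : ℕ} (hC : ∀ x, ‖fderiv ℝ V x‖ ≤ C * (1 + ‖x‖) ^ n)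
    (hCw : ∀ x, ‖w x‖ ≤ Cw * (1 + ‖x‖)) (hL : ∀ x, |Δ V x| ≤ L * (1 + ‖x‖) ^ k)
    (hΔ : Continuous (Δ V)) :
    ∫ x, fderiv ℝ V x (w x) ∂((volume : Measure E).tilted (gaussianLogWeight m A))
      = ∫ x, Δ V x ∂((volume : Measure E).tilted (gaussianLogWeight m A)) := by
  set μ := (volume : Measure E).tilted (gaussianLogWeight m A)
  have hV1 : Continuous (fderiv ℝ V) := hV.continuous_fderiv two_ne_zero
  have hβ := continuous_truncParaboloid (E := E)
  have hC0 : 0 ≤ C := by simpa using (norm_nonneg _).trans (hC 0)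
  have hCw0 : 0 ≤ Cw := by simpa using (norm_nonneg _).trans (hCw 0)
  have hpoly : ∀ (c : ℝ) (j : ℕ), 0 ≤ c → Integrable (fun x : E => c * (1 + ‖x‖) ^ j) μ :=
    fun c j hc => integrable_of_norm_le_mul_one_add_norm_pow (C := c) (n := j)
      (Continuous.aestronglyMeasurable (by fun_prop))
      fun x => by rw [Real.norm_of_nonneg (by positivity)]
  have hL0 : 0 ≤ L := by simpa using (abs_nonneg _).trans (hL 0)
  have hlim : ∀ x : E, Filter.Tendsto (fun r : ℝ => truncParaboloid (r • x))
      (nhdsWithin 0 (Set.Ioo 0 1)) (nhds 1) := fun x => by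
    have : Continuous fun r : ℝ => truncParaboloid (r • x) := by fun_prop
    have h := this.tendsto 0
    rw [zero_smul, truncParaboloid_zero] at h
    exact h.mono_left nhdsWithin_le_nhds
  have hr0 : Filter.Tendsto (fun r : ℝ => r) (nhdsWithin 0 (Set.Ioo 0 1)) (nhds 0) :=
    Filter.tendsto_id.mono_left nhdsWithin_le_nhds
  have hne : (nhdsWithin (0 : ℝ) (Set.Ioo 0 1)).NeBot :=
    left_nhdsWithin_Ioo_neBot one_pos
  -- As `r → 0` the cutoff tends to `1` and its derivative term vanishes; restricting to `0 < r < 1`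
  -- yields a polynomial dominating function.
  have t1 : Filter.Tendsto (fun r : ℝ => ∫ x, (4 * r ^ 2 * truncParaboloid (r • x) * fderiv ℝ V x x
        + truncParaboloid (r • x) ^ 2 * fderiv ℝ V x (w x)) ∂μ)
      (nhdsWithin 0 (Set.Ioo 0 1)) (nhds (∫ x, fderiv ℝ V x (w x) ∂μ)) := by
    refine tendsto_integral_filter_of_dominated_convergence
      (fun x => C * (4 + Cw) * (1 + ‖x‖) ^ (n + 1)) ?_ ?_ (hpoly _ _ (by positivity)) ?_
    · exact .of_forall fun r => Continuous.aestronglyMeasurable (by fun_prop)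
    · filter_upwards [self_mem_nhdsWithin] with r hr
      refine .of_forall fun x => ?_
      have b0 := truncParaboloid_nonneg (r • x)
      have b1 := truncParaboloid_le_one (r • x)
      have hr2 : r ^ 2 ≤ 1 := pow_le_one₀ hr.1.le hr.2.le
      have hb2 : truncParaboloid (r • x) ^ 2 ≤ 1 := pow_le_one₀ b0 b1
      have d1 : ‖fderiv ℝ V x x‖ ≤ C * (1 + ‖x‖) ^ n * (1 + ‖x‖) :=
        ((fderiv ℝ V x).le_opNorm x).trans
          (mul_le_mul (hC x) (by linarith) (norm_nonneg _) (by positivity))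
      have d2 : ‖fderiv ℝ V x (w x)‖ ≤ C * (1 + ‖x‖) ^ n * (Cw * (1 + ‖x‖)) :=
        ((fderiv ℝ V x).le_opNorm (w x)).trans
          (mul_le_mul (hC x) (hCw x) (norm_nonneg _) (by positivity))
      refine (norm_add_le _ _).trans ?_
      rw [norm_mul (4 * r ^ 2 * _), norm_mul (_ ^ 2), Real.norm_of_nonneg (by positivity),
        Real.norm_of_nonneg (sq_nonneg (truncParaboloid (r • x)))]
      calc 4 * r ^ 2 * truncParaboloid (r • x) * ‖fderiv ℝ V x x‖
            + truncParaboloid (r • x) ^ 2 * ‖fderiv ℝ V x (w x)‖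
          ≤ 4 * 1 * 1 * (C * (1 + ‖x‖) ^ n * (1 + ‖x‖))
            + 1 * (C * (1 + ‖x‖) ^ n * (Cw * (1 + ‖x‖))) := by gcongr
        _ = _ := by ring
    · refine .of_forall fun x => ?_
      have := ((((hr0.pow 2).const_mul 4).mul (hlim x)).mul_const (fderiv ℝ V x x)).add
        (((hlim x).pow 2).mul_const (fderiv ℝ V x (w x)))
      simpa using this
  have t2 : Filter.Tendsto (fun r : ℝ => ∫ x, Δ V x * truncParaboloid (r • x) ^ 2 ∂μ)
      (nhdsWithin 0 (Set.Ioo 0 1)) (nhds (∫ x, Δ V x ∂μ)) := by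
    refine tendsto_integral_filter_of_dominated_convergence
      (fun x => L * (1 + ‖x‖) ^ k) ?_ ?_ (hpoly _ _ hL0) ?_
    · exact .of_forall fun r => Continuous.aestronglyMeasurable (by fun_prop)
    · refine .of_forall fun r => .of_forall fun x => ?_
      rw [norm_mul, Real.norm_of_nonneg (sq_nonneg (truncParaboloid (r • x)))]
      exact (mul_le_of_le_one_right (norm_nonneg _)
        (pow_le_one₀ (truncParaboloid_nonneg _) (truncParaboloid_le_one _))).trans (hL x)
    · refine .of_forall fun x => ?_
      simpa using ((hlim x).pow 2).const_mul (Δ V x)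
  refine tendsto_nhds_unique (t1.congr' ?_) t2
  filter_upwards [self_mem_nhdsWithin] with r hr
  exact integral_truncParaboloid_stein hV hwc hw hr.1

end Stein

/-! ### Lipschitz test functions and the Wasserstein distance. -/

section Wasserstein

variable {E : Type*} [NormedAddCommGroup E] [MeasurableSpace E]

lemma sq_lintegral_le_lintegral_sq {α : Type*} {mα : MeasurableSpace α} {γ : Measure α}
    [IsProbabilityMeasure γ] {h : α → ℝ≥0∞} (hh : AEMeasurable h γ) :
    (∫⁻ x, h x ∂γ) ^ 2 ≤ ∫⁻ x, h x ^ 2 ∂γ := by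
  have := ENNReal.lintegral_mul_le_Lp_mul_Lq γ Real.HolderConjugate.two_two hh
    (aemeasurable_const (b := (1 : ℝ≥0∞)))
  simp only [Pi.mul_apply, mul_one, ENNReal.rpow_ofNat, one_pow, lintegral_const, measure_univ,
    ENNReal.one_rpow] at this
  calc (∫⁻ x, h x ∂γ) ^ 2 ≤ ((∫⁻ x, h x ^ 2 ∂γ) ^ (1 / 2 : ℝ)) ^ 2 := by gcongr
    _ = _ := by
      rw [← ENNReal.rpow_natCast, ← ENNReal.rpow_mul]
      norm_num

variable [SecondCountableTopology E]

lemma wassersteinSq_ne_top {μ ν : Measure E} [IsProbabilityMeasure μ] [IsProbabilityMeasure ν]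
    (hμ : MemLp (fun x => x) 2 μ) (hν : MemLp (fun x => x) 2 ν) :
    wassersteinSq μ ν ≠ ∞ := by
  have hγ : μ.prod ν ∈ transportPlans μ ν := by
    constructor
    · rw [← Measure.fst, Measure.fst_prod]
    · rw [← Measure.snd, Measure.snd_prod]
  refine ne_top_of_le_ne_top ?_ (iInf₂_le (μ.prod ν) hγ)
  have h1 : MemLp (fun p : E × E => p.1 - p.2) 2 (μ.prod ν) :=
    (hμ.comp_measurePreserving measurePreserving_fst).sub
      (hν.comp_measurePreserving measurePreserving_snd)
  have h2 := (h1.integrable_norm_pow two_ne_zero).2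
  rw [hasFiniteIntegral_iff_enorm] at h2
  simpa [enorm_pow] using h2.ne

variable [BorelSpace E]

/-- Kantorovich's inequality for the 2-Wasserstein distance. -/
lemma abs_integral_sub_integral_le_mul_W₂ {μ ν : Measure E} [IsProbabilityMeasure μ]
    [IsProbabilityMeasure ν] (hμ : MemLp (fun x => x) 2 μ) (hν : MemLp (fun x => x) 2 ν)
    {f : E → ℝ} {ℓ : ℝ≥0} (hf : LipschitzWith ℓ f) (hfμ : Integrable f μ)
    (hfν : Integrable f ν) :
    |∫ x, f x ∂μ - ∫ x, f x ∂ν| ≤ ℓ * W₂ μ ν := by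
  set δ := ∫ x, f x ∂μ - ∫ x, f x ∂ν with hδ
  have hplan : ∀ γ ∈ transportPlans μ ν,
      ‖δ‖ₑ ^ 2 ≤ (ℓ : ℝ≥0∞) ^ 2 * ∫⁻ p, ‖p.1 - p.2‖ₑ ^ 2 ∂γ := by
    rintro γ ⟨hγ1, hγ2⟩
    have : IsProbabilityMeasure γ := by
      constructor
      have h := measure_univ (μ := μ)
      rwa [← hγ1, Measure.map_apply measurable_fst .univ, Set.preimage_univ] at h
    have i1 : Integrable (fun p : E × E => f p.1) γ := by
      rw [← hγ1] at hfμ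
      exact hfμ.comp_measurable measurable_fst
    have i2 : Integrable (fun p : E × E => f p.2) γ := by
      rw [← hγ2] at hfν
      exact hfν.comp_measurable measurable_snd
    have e : δ = ∫ p, (f p.1 - f p.2) ∂γ := by
      rw [integral_sub i1 i2, hδ]
      conv_lhs => rw [← hγ1, ← hγ2]
      rw [integral_map measurable_fst.aemeasurable hf.continuous.aestronglyMeasurable,
        integral_map measurable_snd.aemeasurable hf.continuous.aestronglyMeasurable]
    have h1 : ‖δ‖ₑ ≤ ∫⁻ p, (ℓ : ℝ≥0∞) * ‖p.1 - p.2‖ₑ ∂γ := by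
      rw [e]
      refine (enorm_integral_le_lintegral_enorm _).trans (lintegral_mono fun p => ?_)
      have := hf p.1 p.2
      rwa [edist_eq_enorm_sub, edist_eq_enorm_sub] at this
    calc ‖δ‖ₑ ^ 2 ≤ (∫⁻ p, (ℓ : ℝ≥0∞) * ‖p.1 - p.2‖ₑ ∂γ) ^ 2 := by gcongr
      _ ≤ ∫⁻ p, ((ℓ : ℝ≥0∞) * ‖p.1 - p.2‖ₑ) ^ 2 ∂γ :=
        sq_lintegral_le_lintegral_sq (Measurable.aemeasurable (by fun_prop))
      _ = _ := by
        simp_rw [mul_pow]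
        rw [lintegral_const_mul _ (by fun_prop)]
  have hW := wassersteinSq_ne_top hμ hν
  have h2 : ‖δ‖ₑ ^ 2 ≤ (ℓ : ℝ≥0∞) ^ 2 * wassersteinSq μ ν := by
    unfold wassersteinSq
    -- The infimum is reached by dividing by `ℓ²`. When `ℓ = 0` a single plan suffices, and the
    -- product coupling provides one.
    rcases eq_or_ne ℓ 0 with rfl | hℓ
    · have hγ : μ.prod ν ∈ transportPlans μ ν := by
        constructor
        · rw [← Measure.fst, Measure.fst_prod]
        · rw [← Measure.snd, Measure.snd_prod]
      simpa using hplan _ hγ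
    · have hℓ1 : (ℓ : ℝ≥0∞) ^ 2 ≠ 0 := by simpa using hℓ
      have hℓ2 : (ℓ : ℝ≥0∞) ^ 2 ≠ ∞ := by simp
      have : ‖δ‖ₑ ^ 2 / (ℓ : ℝ≥0∞) ^ 2 ≤ _ :=
        le_iInf₂ fun γ hγ => ENNReal.div_le_of_le_mul' (hplan γ hγ)
      calc ‖δ‖ₑ ^ 2 = (ℓ : ℝ≥0∞) ^ 2 * (‖δ‖ₑ ^ 2 / (ℓ : ℝ≥0∞) ^ 2) :=
            (ENNReal.mul_div_cancel hℓ1 hℓ2).symm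
        _ ≤ _ := by gcongr
  have h3 := ENNReal.toReal_mono (ENNReal.mul_ne_top (by simp) hW) h2
  simp only [ENNReal.toReal_pow, toReal_enorm, ENNReal.toReal_mul, ENNReal.coe_toReal,
    Real.norm_eq_abs] at h3
  have h4 : |δ| ^ 2 ≤ (ℓ * W₂ μ ν) ^ 2 := by
    rwa [W₂, mul_pow, Real.sq_sqrt ENNReal.toReal_nonneg]
  exact (pow_le_pow_iff_left₀ (abs_nonneg _)
    (mul_nonneg ℓ.coe_nonneg (Real.sqrt_nonneg _)) two_ne_zero).1 h4

end Wasserstein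

/-! ### Variance reduction by a centred control variate. -/

section Variance

variable {Ω E : Type*} [MeasurableSpace Ω] [NormedAddCommGroup E] [InnerProductSpace ℝ E]
  {P : Measure Ω}

lemma vecVariance_eq_ofReal [IsProbabilityMeasure P] {Y : Ω → E} (hY : MemLp Y 2 P) :
    vecVariance Y P = ENNReal.ofReal (∫ ω, ‖Y ω - ∫ ω', Y ω' ∂P‖ ^ 2 ∂P) := by
  have h : MemLp (fun ω => Y ω - ∫ ω', Y ω' ∂P) 2 P := hY.sub (memLp_const _)
  rw [ofReal_integral_eq_lintegral_ofReal (h.integrable_norm_pow two_ne_zero)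
    (.of_forall fun ω => sq_nonneg _), vecVariance]
  refine lintegral_congr fun ω => ?_
  rw [ENNReal.ofReal_pow (norm_nonneg _), ofReal_norm]

/-- Subtracting a centred control variate that is sufficiently correlated with `Y` reduces the
variance. -/
lemma vecVariance_sub_lt [CompleteSpace E] [IsProbabilityMeasure P] {Y D : Ω → E}
    (hY : MemLp Y 2 P) (hD : MemLp D 2 P) (h0 : ∫ ω, D ω ∂P = 0)
    (h : ∫ ω, ‖D ω‖ ^ 2 ∂P < 2 * ∫ ω, inner ℝ (D ω) (Y ω) ∂P) :
    vecVariance (fun ω => Y ω - D ω) P < vecVariance Y P := by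
  have hYi := hY.integrable one_le_two
  have hDi := hD.integrable one_le_two
  have hYD : MemLp (fun ω => Y ω - D ω) 2 P := hY.sub hD
  rw [vecVariance_eq_ofReal hYD, vecVariance_eq_ofReal hY]
  have e1 : ∫ ω, (Y ω - D ω) ∂P = ∫ ω, Y ω ∂P := by
    rw [integral_sub hYi hDi, h0, sub_zero]
  rw [ENNReal.ofReal_lt_ofReal_iff_of_nonneg (integral_nonneg fun ω => sq_nonneg _)]
  rw [e1]
  set e := ∫ ω, Y ω ∂P
  have hYe : MemLp (fun ω => Y ω - e) 2 P := hY.sub (memLp_const _)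
  have i1 : Integrable (fun ω => ‖Y ω - e‖ ^ 2) P := hYe.integrable_norm_pow two_ne_zero
  have i2 : Integrable (fun ω => ‖D ω‖ ^ 2) P := hD.integrable_norm_pow two_ne_zero
  have i3 : Integrable (fun ω => inner ℝ (D ω) (Y ω)) P := by
    refine (i2.add (hY.integrable_norm_pow two_ne_zero)).mono' (hD.1.inner hY.1)
      (.of_forall fun ω => (norm_inner_le_norm _ _).trans ?_)
    simp only [Pi.add_apply]
    nlinarith [two_mul_le_add_sq ‖D ω‖ ‖Y ω‖, norm_nonneg (D ω), norm_nonneg (Y ω)]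
  have i4 : Integrable (fun ω => inner ℝ e (D ω)) P := hDi.const_inner e
  have e2 : ∀ ω, ‖Y ω - D ω - e‖ ^ 2
      = ‖Y ω - e‖ ^ 2 - 2 * inner ℝ (D ω) (Y ω) + 2 * inner ℝ e (D ω) + ‖D ω‖ ^ 2 := fun ω => by
    rw [show Y ω - D ω - e = (Y ω - e) - D ω by abel, norm_sub_sq_real, inner_sub_left,
      real_inner_comm]
    ring
  have j1 : Integrable (fun ω => ‖Y ω - e‖ ^ 2 - 2 * inner ℝ (D ω) (Y ω)) P :=
    i1.sub (i3.const_mul 2)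
  have j2 : Integrable (fun ω => ‖Y ω - e‖ ^ 2 - 2 * inner ℝ (D ω) (Y ω)
    + 2 * inner ℝ e (D ω)) P := j1.add (i4.const_mul 2)
  simp_rw [e2]
  rw [integral_add j2 i2, integral_add j1 (i4.const_mul 2), integral_sub i1 (i3.const_mul 2),
    integral_const_mul, integral_const_mul, integral_inner hDi, h0, inner_zero_right]
  linarith

end Variance

/-! ### Derivatives of the expected potential and of the log-determinant. -/

section Perturbation

variable {E : Type*} [NormedAddCommGroup E] [InnerProductSpace ℝ E] [FiniteDimensional ℝ E]
  [MeasurableSpace E] [BorelSpace E]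

lemma hasDerivAt_integral_comp_add_smul {μ : Measure E} [IsGaussian μ] {V : E → ℝ}
    (hV : ContDiff ℝ 1 V) {C C' : ℝ} {n : ℕ} (hC' : ∀ x, |V x| ≤ C' * (1 + ‖x‖) ^ n)
    (hC : ∀ x, ‖fderiv ℝ V x‖ ≤ C * (1 + ‖x‖) ^ n)
    (m : E) (L K : E →L[ℝ] E) :
    HasDerivAt (fun s : ℝ => ∫ z, V (m + (L z + s • K z)) ∂μ)
      (∫ z, fderiv ℝ V (m + L z) (K z) ∂μ) 0 := by
  have hV1 : Continuous (fderiv ℝ V) := hV.continuous_fderiv one_ne_zero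
  have hC0 : 0 ≤ C := by simpa using (norm_nonneg _).trans (hC 0)
  have hC0' : 0 ≤ C' := by simpa using (abs_nonneg _).trans (hC' 0)
  set B := 1 + ‖m‖ + ‖L‖ + ‖K‖
  have hB : ∀ (s : ℝ) (z : E), |s| ≤ 1 → 1 + ‖m + (L z + s • K z)‖ ≤ B * (1 + ‖z‖) :=
    fun s z hs => by
      have h1 := norm_add_le m (L z + s • K z)
      have h2 := norm_add_le (L z) (s • K z)
      have h3 := L.le_opNorm z
      have h4 := K.le_opNorm z
      rw [norm_smul, Real.norm_eq_abs] at h2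
      have h5 : |s| * ‖K z‖ ≤ ‖K z‖ := mul_le_of_le_one_left (norm_nonneg _) hs
      have h6 : B * (1 + ‖z‖) = 1 + ‖m‖ + ‖L‖ + ‖K‖ + (1 + ‖m‖) * ‖z‖
        + ‖L‖ * ‖z‖ + ‖K‖ * ‖z‖ := by ring
      have h7 : 0 ≤ (1 + ‖m‖) * ‖z‖ := by positivity
      linarith [norm_nonneg L, norm_nonneg K]
  have key := hasDerivAt_integral_of_dominated_loc_of_deriv_le (μ := μ)
    (F := fun (s : ℝ) z => V (m + (L z + s • K z)))
    (F' := fun s z => fderiv ℝ V (m + (L z + s • K z)) (K z))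
    (bound := fun z => C * B ^ n * ‖K‖ * (1 + ‖z‖) ^ (n + 1)) (x₀ := 0)
    (Metric.ball_mem_nhds 0 one_pos)
    (.of_forall fun s => Continuous.aestronglyMeasurable (hV.continuous.comp (by fun_prop)))
    ?_ (Continuous.aestronglyMeasurable (by fun_prop))
    (.of_forall fun z s hs => ?_) ?_ (.of_forall fun z s _ => ?_)
  · simpa using key.2
  · refine integrable_of_norm_le_mul_one_add_norm_pow (C := C' * B ^ n) (n := n)
      (Continuous.aestronglyMeasurable (hV.continuous.comp (by fun_prop))) fun z => ?_
    refine (hC' _).trans ?_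
    rw [mul_assoc, ← mul_pow]
    have := hB 0 z (by simp)
    gcongr
  · rw [Metric.mem_ball, dist_zero_right, Real.norm_eq_abs] at hs
    have h1 := hB s z hs.le
    have h2 : ‖K z‖ ≤ ‖K‖ * (1 + ‖z‖) :=
      (K.le_opNorm z).trans (by gcongr; linarith)
    calc ‖fderiv ℝ V (m + (L z + s • K z)) (K z)‖
        ≤ ‖fderiv ℝ V (m + (L z + s • K z))‖ * ‖K z‖ := ContinuousLinearMap.le_opNorm _ _
      _ ≤ (C * (B * (1 + ‖z‖)) ^ n) * (‖K‖ * (1 + ‖z‖)) := by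
        have h3 := (hC (m + (L z + s • K z))).trans
          (mul_le_mul_of_nonneg_left (pow_le_pow_left₀ (by positivity) h1 n) hC0)
        gcongr
      _ = _ := by rw [mul_pow]; ring
  · refine integrable_of_norm_le_mul_one_add_norm_pow (C := C * B ^ n * ‖K‖) (n := n + 1)
      (Continuous.aestronglyMeasurable (by fun_prop)) fun z => ?_
    rw [Real.norm_of_nonneg (by positivity)]
  · have h1 : HasDerivAt (fun s : ℝ => m + (L z + s • K z)) (K z) s := by
      simpa using (((hasDerivAt_id s).smul_const (K z)).const_add (L z)).const_add m
    exact (hV.differentiable one_ne_zero _).hasFDerivAt.comp_hasDerivAt s h1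

lemma HasDerivAt.nonneg_of_forall_le {φ : ℝ → ℝ} {φ' a : ℝ} (h : HasDerivAt φ φ' a)
    (hmin : ∀ s, a < s → φ a ≤ φ s) : 0 ≤ φ' := by
  have h1 := (hasDerivWithinAt_iff_tendsto_slope' (s := Set.Ioi a) (by simp)).1
    h.hasDerivWithinAt
  refine ge_of_tendsto h1 ?_
  filter_upwards [self_mem_nhdsWithin] with s hs
  rw [slope_def_field]
  exact div_nonneg (sub_nonneg.2 (hmin s hs)) (sub_nonneg.2 (le_of_lt hs))

/-- The determinant is `1 + s Tr M` plus `s²` times a polynomial in `s`. -/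
lemma hasDerivAt_log_det_one_add_smul {ι : Type*} [Fintype ι] [DecidableEq ι]
    (M : Matrix ι ι ℝ) :
    HasDerivAt (fun s : ℝ => Real.log (1 + s • M).det) M.trace 0 := by
  have h : HasDerivAt (fun s : ℝ => (1 + s • M).det) M.trace 0 := by
    rw [funext fun s => Matrix.det_one_add_smul s M]
    have h1 := ((hasDerivAt_id (0 : ℝ)).const_mul M.trace).const_add 1
    have h2 := ((1 + (Polynomial.X : Polynomial ℝ) • M.map Polynomial.C).det.divX.divX.hasDerivAt
      (0 : ℝ)).mul (hasDerivAt_pow 2 (0 : ℝ))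
    exact (h1.add h2).congr_deriv (by simp)
  simpa using h.log (by simp)

end Perturbation

/-! ### Gaussians parametrised by matrices, and their scores. -/

section MatrixGaussian

open scoped MatrixOrder

variable {ι : Type*} [Fintype ι] [DecidableEq ι]

/-- The continuous linear equivalence of Euclidean space induced by an invertible matrix. -/
noncomputable def Matrix.toEuclideanCLE (M : Matrix ι ι ℝ) (hM : IsUnit M.det) :
    EuclideanSpace ℝ ι ≃L[ℝ] EuclideanSpace ℝ ι :=
  ContinuousLinearEquiv.equivOfInverse (Matrix.toEuclideanCLM (𝕜 := ℝ) M)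
    (Matrix.toEuclideanCLM (𝕜 := ℝ) M⁻¹)
    (fun x => by
      rw [← mul_apply_eq_comp, ← map_mul, Matrix.nonsing_inv_mul M hM, map_one,
        one_apply_eq_self])
    (fun x => by
      rw [← mul_apply_eq_comp, ← map_mul, Matrix.mul_nonsing_inv M hM, map_one,
        one_apply_eq_self])

lemma Matrix.toEuclideanCLE_apply (M : Matrix ι ι ℝ) (hM : IsUnit M.det)
    (x : EuclideanSpace ℝ ι) :
    M.toEuclideanCLE hM x = Matrix.toEuclideanCLM (𝕜 := ℝ) M x := rfl

lemma Matrix.toEuclideanCLE_symm_apply (M : Matrix ι ι ℝ) (hM : IsUnit M.det)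
    (x : EuclideanSpace ℝ ι) :
    (M.toEuclideanCLE hM).symm x = Matrix.toEuclideanCLM (𝕜 := ℝ) M⁻¹ x := rfl

lemma Matrix.det_toEuclideanCLE (M : Matrix ι ι ℝ) (hM : IsUnit M.det) :
    LinearMap.det (M.toEuclideanCLE hM : EuclideanSpace ℝ ι →ₗ[ℝ] EuclideanSpace ℝ ι)
      = M.det :=
  LinearMap.det_toLpLin 2 M

lemma Matrix.IsHermitian.inner_toEuclideanCLM_comm {M : Matrix ι ι ℝ} (hM : M.IsHermitian)
    (x y : EuclideanSpace ℝ ι) :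
    inner ℝ (Matrix.toEuclideanCLM (𝕜 := ℝ) M x) y
      = inner ℝ x (Matrix.toEuclideanCLM (𝕜 := ℝ) M y) := by
  have h : ContinuousLinearMap.adjoint (Matrix.toEuclideanCLM (𝕜 := ℝ) M)
      = Matrix.toEuclideanCLM (𝕜 := ℝ) M := by
    rw [← ContinuousLinearMap.star_eq_adjoint, ← map_star, Matrix.star_eq_conjTranspose, hM.eq]
  conv_lhs => rw [← h]
  exact ContinuousLinearMap.adjoint_inner_left _ _ _

lemma Matrix.PosDef.isUnit_det' {M : Matrix ι ι ℝ} (hM : M.PosDef) : IsUnit M.det :=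
  hM.det_pos.ne'.isUnit

lemma Matrix.PosDef.mul_self {M : Matrix ι ι ℝ} (hM : M.PosDef) : (M * M).PosDef := by
  have h : (M * M).PosSemidef := by
    have := Matrix.posSemidef_conjTranspose_mul_self M
    rwa [hM.isHermitian.eq] at this
  exact h.posDef_iff_det_ne_zero.2 (by
    rw [Matrix.det_mul]
    exact mul_ne_zero hM.det_pos.ne' hM.det_pos.ne')

lemma Matrix.PosDef.sqrt_mul_sqrt {S : Matrix ι ι ℝ} (hS : S.PosDef) :
    CFC.sqrt S * CFC.sqrt S = S :=
  CFC.sqrt_mul_sqrt_self S hS.posSemidef.nonneg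

lemma Matrix.PosDef.posDef_sqrt {S : Matrix ι ι ℝ} (hS : S.PosDef) : (CFC.sqrt S).PosDef := by
  have h : (CFC.sqrt S).PosSemidef := Matrix.nonneg_iff_posSemidef.1 (CFC.sqrt_nonneg S)
  refine h.posDef_iff_det_ne_zero.2 fun h0 => hS.det_pos.ne' ?_
  rw [← hS.sqrt_mul_sqrt, Matrix.det_mul, h0, zero_mul]

lemma Matrix.PosDef.inv_eq_inv_sqrt_mul {S : Matrix ι ι ℝ} (hS : S.PosDef) :
    S⁻¹ = (CFC.sqrt S)⁻¹ * (CFC.sqrt S)⁻¹ := by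
  conv_lhs => rw [← hS.sqrt_mul_sqrt, Matrix.mul_inv_rev]

lemma multivariateGaussian_eq_map {S : Matrix ι ι ℝ} (hS : S.PosDef) (m : EuclideanSpace ℝ ι) :
    multivariateGaussian m S = (stdGaussian (EuclideanSpace ℝ ι)).map
      (fun x => m + (CFC.sqrt S).toEuclideanCLE hS.posDef_sqrt.isUnit_det' x) := rfl

lemma multivariateGaussian_eq_tilted {S : Matrix ι ι ℝ} (hS : S.PosDef)
    (m : EuclideanSpace ℝ ι) :
    multivariateGaussian m S = (volume : Measure (EuclideanSpace ℝ ι)).tilted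
      (gaussianLogWeight m ((CFC.sqrt S).toEuclideanCLE hS.posDef_sqrt.isUnit_det')) := by
  rw [multivariateGaussian_eq_map hS, stdGaussian_map_affine]

lemma inner_toEuclideanCLM_inv_eq {S : Matrix ι ι ℝ} (hS : S.PosDef)
    (m x v : EuclideanSpace ℝ ι) :
    inner ℝ (Matrix.toEuclideanCLM (𝕜 := ℝ) S⁻¹ (x - m)) v
      = inner ℝ (((CFC.sqrt S).toEuclideanCLE hS.posDef_sqrt.isUnit_det').symm (x - m))
        (((CFC.sqrt S).toEuclideanCLE hS.posDef_sqrt.isUnit_det').symm v) := by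
  rw [Matrix.toEuclideanCLE_symm_apply, Matrix.toEuclideanCLE_symm_apply,
    hS.inv_eq_inv_sqrt_mul, map_mul, mul_apply_eq_comp,
    hS.posDef_sqrt.inv.isHermitian.inner_toEuclideanCLM_comm]

lemma toEuclideanCLM_inv_sqrt {S : Matrix ι ι ℝ} (hS : S.PosDef) (z : EuclideanSpace ℝ ι) :
    Matrix.toEuclideanCLM (𝕜 := ℝ) S⁻¹ (Matrix.toEuclideanCLM (𝕜 := ℝ) (CFC.sqrt S) z)
      = Matrix.toEuclideanCLM (𝕜 := ℝ) (CFC.sqrt S)⁻¹ z := by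
  rw [← mul_apply_eq_comp, ← map_mul, hS.inv_eq_inv_sqrt_mul, mul_assoc,
    Matrix.nonsing_inv_mul _ hS.posDef_sqrt.isUnit_det', mul_one]

lemma integral_inner_toEuclideanCLM_stdGaussian (M : Matrix ι ι ℝ) :
    ∫ z, inner ℝ z (Matrix.toEuclideanCLM (𝕜 := ℝ) M z) ∂(stdGaussian (EuclideanSpace ℝ ι))
      = M.trace := by
  have hL : ∀ i : ι, MemLp (fun z : EuclideanSpace ℝ ι => z i) 2
      (stdGaussian (EuclideanSpace ℝ ι)) := fun i =>
    IsGaussian.memLp_dual _ (EuclideanSpace.proj (𝕜 := ℝ) i) 2 (by simp)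
  have h0 : ∀ i : ι, ∫ z, z i ∂(stdGaussian (EuclideanSpace ℝ ι)) = 0 := fun i =>
    integral_strongDual_stdGaussian (EuclideanSpace.proj (𝕜 := ℝ) i)
  have h : ∀ i j : ι, ∫ z, z i * z j ∂(stdGaussian (EuclideanSpace ℝ ι))
      = (1 : Matrix ι ι ℝ) i j := fun i j => by
    have h1 := covariance_eval_multivariateGaussian (μ := 0) (S := (1 : Matrix ι ι ℝ))
      Matrix.PosSemidef.one i j
    rw [multivariateGaussian_zero_one, covariance_eq_sub (hL i) (hL j), h0, zero_mul,
      sub_zero] at h1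
    exact h1
  have e : ∀ z : EuclideanSpace ℝ ι, inner ℝ z (Matrix.toEuclideanCLM (𝕜 := ℝ) M z)
      = ∑ i, ∑ j, M i j * (z i * z j) := fun z => by
    rw [Matrix.inner_toEuclideanCLM]
    simp only [dotProduct, Matrix.mulVec, Finset.mul_sum]
    exact Finset.sum_congr rfl fun i _ => Finset.sum_congr rfl fun j _ => by ring
  have hi : ∀ i j : ι, Integrable (fun z : EuclideanSpace ℝ ι => M i j * (z i * z j))
      (stdGaussian (EuclideanSpace ℝ ι)) := fun i j =>
    ((hL i).integrable_mul (hL j)).const_mul _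
  simp_rw [e]
  rw [integral_finsetSum _ fun i _ => integrable_finsetSum _ fun j _ => hi i j]
  refine Finset.sum_congr rfl fun i _ => ?_
  rw [integral_finsetSum _ fun j _ => hi i j]
  simp_rw [integral_const_mul, h]
  simp [Matrix.one_apply]

/-- The score of a nondegenerate Gaussian has second moment `Tr Σ⁻¹`. -/
lemma integral_norm_sq_toEuclideanCLM_inv {S : Matrix ι ι ℝ} (hS : S.PosDef)
    (m : EuclideanSpace ℝ ι) :
    ∫ x, ‖Matrix.toEuclideanCLM (𝕜 := ℝ) S⁻¹ (x - m)‖ ^ 2 ∂(multivariateGaussian m S)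
      = (S⁻¹).trace := by
  rw [multivariateGaussian, integral_map (Measurable.aemeasurable (by fun_prop))
    (Continuous.aestronglyMeasurable (by fun_prop)),
    ← integral_inner_toEuclideanCLM_stdGaussian]
  congr 1
  ext z
  rw [add_sub_cancel_left, toEuclideanCLM_inv_sqrt hS, ← real_inner_self_eq_norm_sq,
    hS.posDef_sqrt.inv.isHermitian.inner_toEuclideanCLM_comm, ← mul_apply_eq_comp,
    ← map_mul, ← hS.inv_eq_inv_sqrt_mul]

lemma integral_toEuclideanCLM_inv (S : Matrix ι ι ℝ) (m : EuclideanSpace ℝ ι) :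
    ∫ x, Matrix.toEuclideanCLM (𝕜 := ℝ) S⁻¹ (x - m) ∂(multivariateGaussian m S) = 0 := by
  have h : Integrable (fun x => x) (multivariateGaussian m S) := IsGaussian.integrable_id
  have h2 : Integrable (fun x => x - m) (multivariateGaussian m S) := h.sub (integrable_const m)
  rw [ContinuousLinearMap.integral_comp_comm _ h2, integral_sub h (integrable_const m)]
  simp

/-- A positive definite `R` is the square root of its own square, so covariances can be varied
through their roots without differentiating a matrix square root. -/
lemma multivariateGaussian_mul_self {R : Matrix ι ι ℝ} (hR : R.PosDef)
    (m : EuclideanSpace ℝ ι) :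
    multivariateGaussian m (R * R) = (stdGaussian (EuclideanSpace ℝ ι)).map
      (fun x => m + R.toEuclideanCLE hR.isUnit_det' x) := by
  rw [multivariateGaussian, CFC.sqrt_mul_self R hR.posSemidef.nonneg]
  rfl

end MatrixGaussian

/-! ### First-order optimality condition. -/

section Optimality

open scoped MatrixOrder

variable {d : ℕ}

/-- First-order optimality of the Gaussian approximation under the perturbations
`√Σ + s √Σ⁻¹`, `s ≥ 0`, of the square root of the covariance matrix. -/
lemma IsOptimalGaussian.trace_inv_le_integral {V : EuclideanSpace ℝ (Fin d) → ℝ}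
    (hV : ContDiff ℝ 2 V) (hint : Integrable (fun x => Real.exp (-V x)) volume)
    {C C' : ℝ} {n : ℕ} (hC' : ∀ x, |V x| ≤ C' * (1 + ‖x‖) ^ n)
    (hC : ∀ x, ‖fderiv ℝ V x‖ ≤ C * (1 + ‖x‖) ^ n)
    {m : EuclideanSpace ℝ (Fin d)} {S : Matrix (Fin d) (Fin d) ℝ} (hS : S.PosDef)
    (hopt : IsOptimalGaussian V (multivariateGaussian m S)) :
    (S⁻¹).trace ≤ ∫ x, fderiv ℝ V x (Matrix.toEuclideanCLM (𝕜 := ℝ) S⁻¹ (x - m))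
      ∂(multivariateGaussian m S) := by
  set R := CFC.sqrt S with hRdef
  have hR : R.PosDef := hS.posDef_sqrt
  have hRR : R * R = S := hS.sqrt_mul_sqrt
  have hRu := hR.isUnit_det'
  obtain ⟨a, ha⟩ := toReal_klDiv_gaussian hV.continuous hint hC'
  -- Up to a constant, `φ` is the divergence along the path `R + s R⁻¹ = R (1 + s S⁻¹)`: the factor
  -- `det R` is dropped. The direction `R⁻¹` is chosen because `S⁻¹ R z = R⁻¹ z`, so the derivative
  -- at `0` pairs `∇V` with the score.
  set φ : ℝ → ℝ := fun s => ∫ z, V (m + (Matrix.toEuclideanCLM (𝕜 := ℝ) R z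
    + s • Matrix.toEuclideanCLM (𝕜 := ℝ) R⁻¹ z)) ∂(stdGaussian (EuclideanSpace ℝ (Fin d)))
    - Real.log (1 + s • S⁻¹).det with hφ
  have hd : HasDerivAt φ (∫ z, fderiv ℝ V (m + Matrix.toEuclideanCLM (𝕜 := ℝ) R z)
      (Matrix.toEuclideanCLM (𝕜 := ℝ) R⁻¹ z) ∂(stdGaussian (EuclideanSpace ℝ (Fin d)))
      - (S⁻¹).trace) 0 :=
    (hasDerivAt_integral_comp_add_smul (hV.of_le one_le_two) hC' hC m _ _).sub
      (hasDerivAt_log_det_one_add_smul _)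
  have hmin : ∀ s : ℝ, 0 < s → φ 0 ≤ φ s := fun s hs => by
    -- Positive definiteness is immediate for `s > 0`, and the one-sided comparison already gives
    -- the inequality needed.
    have hRs : (R + s • R⁻¹).PosDef := hR.add_posSemidef (hR.inv.smul hs).posSemidef
    have h1 := hopt.2 ⟨m, (R + s • R⁻¹) * (R + s • R⁻¹), hRs.mul_self, rfl⟩
    simp only [Set.mem_ofPred_eq, targetMeasure] at h1
    rw [multivariateGaussian_mul_self hRs, ← hRR, multivariateGaussian_mul_self hR] at h1
    have h2 := ENNReal.toReal_mono (ha _ _).1 h1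
    rw [(ha _ _).2, (ha _ _).2, Matrix.det_toEuclideanCLE, Matrix.det_toEuclideanCLE] at h2
    have h3 : (R + s • R⁻¹).det = R.det * (1 + s • S⁻¹).det := by
      rw [← Matrix.det_mul, mul_add, mul_one, hS.inv_eq_inv_sqrt_mul, mul_smul_comm,
        ← mul_assoc, Matrix.mul_nonsing_inv _ hRu, one_mul]
    have h4 : (1 + s • S⁻¹).det ≠ 0 := fun h => hRs.det_pos.ne' (by rw [h3, h, mul_zero])
    rw [Real.log_abs, Real.log_abs, h3, Real.log_mul hR.det_pos.ne' h4] at h2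
    have e : ∀ z, (R + s • R⁻¹).toEuclideanCLE hRs.isUnit_det' z
        = Matrix.toEuclideanCLM (𝕜 := ℝ) R z
          + s • Matrix.toEuclideanCLM (𝕜 := ℝ) R⁻¹ z := fun z => by
      rw [Matrix.toEuclideanCLE_apply, map_add, map_smul]
      rfl
    simp_rw [e, Matrix.toEuclideanCLE_apply] at h2
    simp only [hφ, zero_smul, add_zero, Matrix.det_one, Real.log_one, sub_zero]
    linarith
  have h := hd.nonneg_of_forall_le hmin
  rw [multivariateGaussian, integral_map (Measurable.aemeasurable (by fun_prop))
    (Continuous.aestronglyMeasurable (by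
      have := hV.continuous_fderiv two_ne_zero
      fun_prop))]
  simp_rw [add_sub_cancel_left, toEuclideanCLM_inv_sqrt hS]
  linarith

end Optimality

/-! ### The variance comparison. -/

theorem mainTheorem1 (d : ℕ) (hd : 1 ≤ d)
    (V : EuclideanSpace ℝ (Fin d) → ℝ) (hV : ContDiff ℝ 2 V)
    (hint : Integrable (fun x => Real.exp (-V x)) volume)
    (ℓ : ℝ≥0) (hℓ : LipschitzWith ℓ (Δ V))
    (mhat : EuclideanSpace ℝ (Fin d)) (Shat : Matrix (Fin d) (Fin d) ℝ) (hShat : Shat.PosDef)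
    (hopt : IsOptimalGaussian V (multivariateGaussian mhat Shat))
    (c : ℝ) (hc : c ∈ Set.Ioo (0 : ℝ) 2) :
    0 < (2 - c) * (Shat⁻¹).trace ∧
    ∀ (m : EuclideanSpace ℝ (Fin d)) (S : Matrix (Fin d) (Fin d) ℝ), S.PosDef →
      2 * ℓ * W₂ (multivariateGaussian m S) (multivariateGaussian mhat Shat)
          + c * |(S⁻¹).trace - (Shat⁻¹).trace| < (2 - c) * (Shat⁻¹).trace →
      ∀ (Ω : Type*) [MeasurableSpace Ω] (P : Measure Ω) (X : Ω → EuclideanSpace ℝ (Fin d)),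
        HasLaw X (multivariateGaussian m S) P →
        vecVariance (fun ω => cvEstimator V c m S (X ω)) P
          < vecVariance (fun ω => mcEstimator V (X ω)) P := by
  have : Nonempty (Fin d) := ⟨⟨0, hd⟩⟩
  refine ⟨mul_pos (sub_pos.2 hc.2) hShat.inv.trace_pos,
    fun m S hS hlt Ω _ P X hX => ?_⟩
  obtain ⟨C', -, hC'⟩ := exists_abs_le_mul_one_add_norm_pow hV hℓ hint
  obtain ⟨C, hC0, hC⟩ := exists_norm_fderiv_le_mul_one_add_norm_pow hV hℓ hint
  have hΔ := abs_laplacian_le hℓ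
  have hstein : ∀ (m : EuclideanSpace ℝ (Fin d)) (S : Matrix (Fin d) (Fin d) ℝ), S.PosDef →
      ∫ x, fderiv ℝ V x (Matrix.toEuclideanCLM (𝕜 := ℝ) S⁻¹ (x - m))
        ∂(multivariateGaussian m S) = ∫ x, Δ V x ∂(multivariateGaussian m S) :=
    fun m S hS => by
      rw [multivariateGaussian_eq_tilted hS]
      refine integral_fderiv_eq_integral_laplacian hV (by fun_prop)
        (inner_toEuclideanCLM_inv_eq hS m)
        (Cw := ‖Matrix.toEuclideanCLM (𝕜 := ℝ) S⁻¹‖ * (1 + ‖m‖)) (k := 1) hC (fun x => ?_)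
        (fun x => by rw [pow_one]; exact hΔ x) hℓ.continuous
      refine (ContinuousLinearMap.le_opNorm _ _).trans ?_
      rw [mul_assoc]
      gcongr
      nlinarith [norm_sub_le x m, norm_nonneg x, norm_nonneg m,
        mul_nonneg (norm_nonneg x) (norm_nonneg m)]
  have hΔi : ∀ (m : EuclideanSpace ℝ (Fin d)) (S : Matrix (Fin d) (Fin d) ℝ),
      Integrable (Δ V) (multivariateGaussian m S) := fun m S =>
    integrable_of_norm_le_mul_one_add_norm_pow (n := 1) hℓ.continuous.aestronglyMeasurable
      (fun x => by rw [pow_one]; exact hΔ x)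
  have hlow : (Shat⁻¹).trace ≤ ∫ x, Δ V x ∂(multivariateGaussian mhat Shat) :=
    (hopt.trace_inv_le_integral hV hint hC' hC hShat).trans_eq (hstein mhat Shat hShat)
  have hW := abs_le.1 (abs_integral_sub_integral_le_mul_W₂ (μ := multivariateGaussian m S)
    (ν := multivariateGaussian mhat Shat) IsGaussian.memLp_two_id IsGaussian.memLp_two_id hℓ
    (hΔi m S) (hΔi mhat Shat))
  have := hX.isProbabilityMeasure
  have hgrad : Continuous (∇ V) :=
    (InnerProductSpace.toDual ℝ (EuclideanSpace ℝ (Fin d))).symm.continuous.comp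
      (hV.continuous_fderiv two_ne_zero)
  have hgrad2 : MemLp (∇ V) 2 (multivariateGaussian m S) := by
    refine (memLp_two_iff_integrable_sq_norm hgrad.aestronglyMeasurable).2
      (integrable_of_norm_le_mul_one_add_norm_pow (C := C ^ 2) (n := 6)
        (hgrad.norm.pow 2).aestronglyMeasurable fun x => ?_)
    have h1 : ‖∇ V x‖ = ‖fderiv ℝ V x‖ :=
      (InnerProductSpace.toDual ℝ (EuclideanSpace ℝ (Fin d))).symm.norm_map _
    rw [Real.norm_of_nonneg (sq_nonneg _), h1]
    calc ‖fderiv ℝ V x‖ ^ 2 ≤ (C * (1 + ‖x‖) ^ 3) ^ 2 := by gcongr; exact hC x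
      _ = _ := by ring
  set D : EuclideanSpace ℝ (Fin d) → EuclideanSpace ℝ (Fin d) :=
    fun x => c • Matrix.toEuclideanCLM (𝕜 := ℝ) S⁻¹ (x - m) with hD
  have hDc : Continuous D := by fun_prop
  have hD2 : MemLp D 2 (multivariateGaussian m S) := by
    have h : MemLp (fun x => x - m) 2 (multivariateGaussian m S) :=
      IsGaussian.memLp_two_id.sub (memLp_const m)
    exact ((Matrix.toEuclideanCLM (𝕜 := ℝ) S⁻¹).comp_memLp' h).const_smul c
  have hcomp : ∀ {f : EuclideanSpace ℝ (Fin d) → EuclideanSpace ℝ (Fin d)},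
      MemLp f 2 (multivariateGaussian m S) → MemLp (fun ω => f (X ω)) 2 P := fun {f} hf => by
    rw [← hX.map_eq] at hf
    exact hf.comp_of_map hX.aemeasurable
  refine vecVariance_sub_lt (hcomp hgrad2) (hcomp hD2) ?_ ?_
  · refine (hX.integral_comp hDc.aestronglyMeasurable).trans ?_
    rw [hD, integral_smul, integral_toEuclideanCLM_inv, smul_zero]
  · have e1 : ∫ ω, ‖D (X ω)‖ ^ 2 ∂P = c ^ 2 * (S⁻¹).trace := by
      refine (hX.integral_comp (f := fun x => ‖D x‖ ^ 2)
        (hDc.norm.pow 2).aestronglyMeasurable).trans ?_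
      simp_rw [hD, norm_smul, mul_pow, Real.norm_eq_abs, sq_abs]
      rw [integral_const_mul, integral_norm_sq_toEuclideanCLM_inv hS]
    have e2 : ∫ ω, inner ℝ (D (X ω)) (mcEstimator V (X ω)) ∂P
        = c * ∫ x, Δ V x ∂(multivariateGaussian m S) := by
      refine (hX.integral_comp (f := fun x => inner ℝ (D x) (∇ V x))
        (hDc.inner hgrad).aestronglyMeasurable).trans ?_
      simp_rw [hD, inner_smul_left, real_inner_comm, inner_gradient_left, conj_trivial]
      rw [integral_const_mul, hstein m S hS]
    change ∫ ω, ‖D (X ω)‖ ^ 2 ∂P < 2 * ∫ ω, inner ℝ (D (X ω)) (mcEstimator V (X ω)) ∂P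
    rw [e1, e2]
    -- The chain is `c Tr S⁻¹ ≤ c Tr Ŝ⁻¹ + c |Tr S⁻¹ - Tr Ŝ⁻¹| < 2 Tr Ŝ⁻¹ - 2ℓ W₂ ≤ 2 𝔼_μ ΔV`, using
    -- `hlow` and `hW` at the end; multiplying by `c > 0` gives the variance criterion.
    have h1 := le_abs_self ((S⁻¹).trace - (Shat⁻¹).trace)
    have h2 : c * (S⁻¹).trace - c * (Shat⁻¹).trace
        ≤ c * |(S⁻¹).trace - (Shat⁻¹).trace| := by
      rw [← mul_sub]
      exact mul_le_mul_of_nonneg_left h1 hc.1.le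
    have h3 : c * (S⁻¹).trace < 2 * ∫ x, Δ V x ∂(multivariateGaussian m S) := by linarith
    have := mul_lt_mul_of_pos_left h3 hc.1
    linarith
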